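/- Fix $\sigma>0$ and $m_1,L,m_2\in(0,\infty]$. Let $\mathcal F$ be the set of all $f$ in the Sobolev space $\mathcal W^2([0,1])$ (square-integrable with square-integrable weak first and second derivatives, identified with the continuous version) such that $|f|\le m_1$ on $[0,1]$ and $\int_0^1 (f'')^2\le L$; for $m_1=L=\infty$ this is all of $\mathcal W^2([0,1])$. Let $\mathcal P$ be the set of probability laws on $\mathbb R$ that have a density, mean $0$ and variance $\sigma^2$. Given design points $x_1,\dots,x_n\in[0,1]$, a function $f\in\mathcal F$ and a noise vector $\boldsymbol\varepsilon=(\varepsilon_1,\dots,\varepsilon_n)$ with i.i.d. entries of law $P\in\mathcal P$, an adversary who knows $f$ and $\boldsymbol\varepsilon$ chooses a set $\mathcal A\subseteq\{1,\dots,n\}$ with $|\mathcal A|\le q$ and the observed responses $\widetilde y=(\widetilde y_1,\dots,\widetilde y_n)$, subject to $\widetilde y_i=f(x_i)+\varepsilon_i$ for $i\notin\mathcal A$ and $|\widetilde y_i|\le m_2$ for $i\in\mathcal A$ (no restriction for $i\in\mathcal A$ if $m_2=\infty$). An estimator assigns to each $\widetilde y\in\mathbb R^n$ a function $\hat f_{\widetilde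 y}$ such that $(\widetilde y,t)\mapsto \hat f_{\widetilde y}(t)$ is measurable. With $\sup_{\mathcal S}$ denoting the supremum over the choices of the adversary, put $$R_2(f,\hat f)=\mathbb E_{\boldsymbol\varepsilon}\Big[\sup_{\mathcal S}\int_0^1 (f(t)-\hat f_{\widetilde y}(t))^2\,dt\Big],\qquad R_\infty(f,\hat f)=\mathbb E_{\boldsymbol\varepsilon}\Big[\sup_{\mathcal S}\sup_{t\in[0,1]}|f(t)-\hat f_{\widetilde y}(t)|^2\Big].$$ Let $\beta\in[0,1]$ and let $q=q(n)$ be natural numbers with $q(n)=\Theta(n^\beta)$ as $n\to\infty$. Then there are a constant $c>0$ and an $n_0$, depending only on $\sigma,m_1,L,m_2,\beta$ and the sequence $q$, such that for all $n\ge n_0$ and all design points $x_1,\dots,x_n\in[0,1]$ $$\inf_{\hat f}\ \sup_{f\in\mathcal F,\,P\in\mathcal P} R_2(f,\hat f)\ \ge\ \begin{cases} c\,n^{-4/5} & \text{if } \beta\le \tfrac{11}{15},\\ c\,n^{-3(1-\beta)} & \text{if } \beta> \tfrac{11}{15},\end{cases}$$ $$\inf_{\hat f}\ \sup_{f\in\mathcal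 F,\,P\in\mathcal P} R_\infty(f,\hat f)\ \ge\ \begin{cases} c\,(\log n/n)^{3/4} & \text{if } \beta\le \tfrac58,\\ c\,n^{-2(1-\beta)} & \text{if } \beta> \tfrac58.\end{cases}$$ -/

import Mathlib

open Set Filter Topology MeasureTheory ProbabilityTheory Asymptotics
open scoped ENNReal ContDiff

namespace AdvRegression

/-- `g` is the weak derivative of `f` on the open interval `(0, 1)`. -/
def HasWeakDeriv (f g : ℝ → ℝ) : Prop :=
  ∀ φ : ℝ → ℝ, ContDiff ℝ ∞ φ → HasCompactSupport φ → tsupport φ ⊆ Ioo 0 1 →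
    ∫ t in Ioo (0 : ℝ) 1, f t * deriv φ t = -∫ t in Ioo (0 : ℝ) 1, g t * φ t

/-- `f` (in its continuous version on `[0, 1]`, so that point evaluations make sense) belongs to
the Sobolev space `W²([0, 1])`, and its weak derivatives of order one and two are `f₁`, `f₂`. -/
structure IsSobolevTwo (f f₁ f₂ : ℝ → ℝ) : Prop where
  continuousOn : ContinuousOn f (Icc 0 1)
  memLp : MemLp f 2 (volume.restrict (Ioo 0 1))
  memLp_fst : MemLp f₁ 2 (volume.restrict (Ioo 0 1))
  memLp_snd : MemLp f₂ 2 (volume.restrict (Ioo 0 1))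
  weakDeriv_fst : HasWeakDeriv f f₁
  weakDeriv_snd : HasWeakDeriv f₁ f₂

/-- The functions `f ∈ W²([0, 1])` with `|f| ≤ m₁` on `[0, 1]` and `∫ (f'')² ≤ L`.
For `m₁ = L = ∞` this is all of `W²([0, 1])`. -/
def sobolevClass (m₁ L : ℝ≥0∞) : Set (ℝ → ℝ) :=
  {f | ∃ f₁ f₂ : ℝ → ℝ, IsSobolevTwo f f₁ f₂ ∧
    (∀ t ∈ Icc (0 : ℝ) 1, ‖f t‖ₑ ≤ m₁) ∧ ∫⁻ t in Ioo (0 : ℝ) 1, ‖f₂ t‖ₑ ^ 2 ≤ L}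

/-- The laws of one noise variable: a probability density, mean zero, variance `σ²`. -/
def noiseLaws (σ : ℝ) : Set (Measure ℝ) :=
  {μ | IsProbabilityMeasure μ ∧ μ ≪ volume ∧ MemLp id 2 μ ∧ ∫ u, u ∂μ = 0 ∧
    Var[id; μ] = σ ^ 2}

/-- The data vectors that the adversary can produce when the noise vector is `ε`: at most `q`
responses are replaced, by values of modulus at most `m₂` (arbitrary values if `m₂ = ∞`). -/
def corruptedData {n : ℕ} (x : Fin n → ℝ) (q : ℕ) (m₂ : ℝ≥0∞) (f : ℝ → ℝ) (ε : Fin n → ℝ) :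
    Set (Fin n → ℝ) :=
  {y | ∃ A : Finset (Fin n), A.card ≤ q ∧ (∀ i, i ∉ A → y i = f (x i) + ε i) ∧
    ∀ i ∈ A, ‖y i‖ₑ ≤ m₂}

/-- Estimators: maps from data vectors to functions, jointly measurable in data and argument. -/
def estimators (n : ℕ) : Set ((Fin n → ℝ) → ℝ → ℝ) :=
  {fhat | Measurable fun p : (Fin n → ℝ) × ℝ => fhat p.1 p.2}

/-- The squared `L²([0, 1])` distance. -/
noncomputable def lossTwo (f g : ℝ → ℝ) : ℝ≥0∞ :=
  ∫⁻ t in Icc (0 : ℝ) 1, ‖f t - g t‖ₑ ^ 2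

/-- The squared supremum distance on `[0, 1]`. -/
noncomputable def lossSup (f g : ℝ → ℝ) : ℝ≥0∞ :=
  (⨆ t ∈ Icc (0 : ℝ) 1, ‖f t - g t‖ₑ) ^ 2

/-- The risk `E_ε [ sup_S loss (f, fhat) ]`, where `ε` has i.i.d. entries of law `μ` and the
adversary picks the corrupted data after seeing `ε`. -/
noncomputable def risk (loss : (ℝ → ℝ) → (ℝ → ℝ) → ℝ≥0∞) {n : ℕ} (x : Fin n → ℝ) (q : ℕ)
    (m₂ : ℝ≥0∞) (μ : Measure ℝ) (f : ℝ → ℝ) (fhat : (Fin n → ℝ) → ℝ → ℝ) : ℝ≥0∞ :=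
  ∫⁻ ε, ⨆ y ∈ corruptedData x q m₂ f ε, loss f (fhat y) ∂(Measure.pi fun _ : Fin n => μ)

/-- The minimax risk `inf_fhat sup_{f, μ} E_ε [ sup_S loss (f, fhat) ]`. -/
noncomputable def minimaxRisk (loss : (ℝ → ℝ) → (ℝ → ℝ) → ℝ≥0∞) (σ : ℝ) (m₁ L m₂ : ℝ≥0∞)
    {n : ℕ} (x : Fin n → ℝ) (q : ℕ) : ℝ≥0∞ :=
  ⨅ fhat ∈ estimators n, ⨆ f ∈ sobolevClass m₁ L, ⨆ μ ∈ noiseLaws σ, risk loss x q m₂ μ f fhat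

end AdvRegression

/-!
Both losses obey two lower bounds, each valid for every `β`; the four cases of the theorem select
the relevant ones.

*Without corruption.* An adversary who changes nothing leaves ordinary nonparametric regression with
fixed design, and Gaussian noise is an admissible law. All comparisons rest on
`gaussian_mixture_test`: if `M` shifts `d j` of a centred Gaussian vector satisfy
`∑ j, ∑ k, exp (⟪d j, d k⟫ / σ²) ≤ 2 M²`, the shifted laws, averaged, cannot be told from the
centred one. With `Λ` the averaged likelihood ratio this follows from `min 1 Λ ≥ Λ - Λ² / 4`,
which integrates to at least `1 / 2`. The unit interval is cut into `m` cells, each carrying a bump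
of height `A`; at least half of the cells hold at most `2 n / m` design points (`sparseCells`),
wherever the design points are.
For the squared `L²` loss, `m ≈ n^(1/5)` and `A ≈ m^(-2)`, and Assouad's argument over all subsets
of bumps (`minimaxRisk_lossTwo_ge_bumps`) gives `A² ≈ n^(-4/5)`. For the supremum loss,
`m ≈ (n / log n)^(1/4)` and `A ≈ m^(-3/2)`; testing zero against a random single bump
(`minimaxRisk_lossSup_ge_bumps`) gives `A² ≈ (log n / n)^(3/4)`.

*With corruption.* Two constants `± δ` with `δ ≈ σ q / n` are made indistinguishable. The noise laws
are chosen such that the responses are distributed as `± s w`, with `w` drawn from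
`(1 - p) U[-1, 1] + p U(1, 2]` and `p ≈ q / n`. Replacing responses of modulus larger than `s` by `0`
(a value allowed for any `m₂`) makes the two laws equal, and by Markov's inequality at most `q`
replacements are needed with probability at least `1 / 2`. Hence the risk is at least of order
`δ² ≈ n^(-2 (1 - β))` for both losses (`minimaxRisk_ge_erasure`). For the squared `L²` loss this is
stronger than the required `n^(-3 (1 - β))`.
-/

namespace AdvRegression

open scoped NNReal

/-! ### Gaussian likelihood ratios and testing against a mixture -/

theorem lintegral_pi_prod {n : ℕ} (μ : Fin n → Measure ℝ) [∀ i, IsProbabilityMeasure (μ i)]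
    (f : Fin n → ℝ → ℝ≥0∞) (hf : ∀ i, Measurable (f i)) :
    ∫⁻ z, ∏ i, f i (z i) ∂(Measure.pi μ) = ∏ i, ∫⁻ u, f i u ∂(μ i) := by
  have h := lintegral_prod_eq_prod_lintegral_of_indepFun (μ := Measure.pi μ) (s := Finset.univ)
    (X := fun i z => f i (z i)) (iIndepFun_pi fun i => (hf i).aemeasurable)
    (fun i => (hf i).comp (measurable_pi_apply i))
  rw [h]
  refine Finset.prod_congr rfl fun i _ => ?_
  exact (measurePreserving_eval μ i).lintegral_comp (hf i)

theorem pi_eq_withDensity {n : ℕ} (μ ν : Fin n → Measure ℝ) [∀ i, IsProbabilityMeasure (μ i)]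
    [∀ i, IsProbabilityMeasure (ν i)]
    (f : Fin n → ℝ → ℝ≥0∞) (hf : ∀ i, Measurable (f i)) (hν : ∀ i, ν i = (μ i).withDensity (f i)) :
    Measure.pi ν = (Measure.pi μ).withDensity fun z => ∏ i, f i (z i) := by
  refine Measure.pi_eq fun s hs => ?_
  rw [withDensity_apply _ (MeasurableSet.univ_pi hs), ← lintegral_indicator (MeasurableSet.univ_pi hs)]
  have : ∀ z : Fin n → ℝ, (Set.univ.pi s).indicator (fun z => ∏ i, f i (z i)) z
      = ∏ i, (s i).indicator (f i) (z i) := by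
    intro z
    by_cases h : z ∈ Set.univ.pi s
    · rw [indicator_of_mem h]
      exact Finset.prod_congr rfl fun i _ => (indicator_of_mem (h i (mem_univ i)) _).symm
    · rw [indicator_of_notMem h]
      simp only [mem_univ_pi, not_forall] at h
      obtain ⟨i, hi⟩ := h
      exact (Finset.prod_eq_zero (Finset.mem_univ i) (indicator_of_notMem hi _)).symm
  simp_rw [this]
  rw [lintegral_pi_prod μ _ fun i => (hf i).indicator (hs i)]
  refine Finset.prod_congr rfl fun i _ => ?_
  rw [lintegral_indicator (hs i), hν i, withDensity_apply _ (hs i)]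


/-- The likelihood ratio of the shifted against the centred Gaussian law with variance `v`. -/
noncomputable def gaussRatio (v : ℝ≥0) (a z : ℝ) : ℝ≥0∞ :=
  ENNReal.ofReal (Real.exp (a * z / v - a ^ 2 / (2 * v)))

theorem measurable_gaussRatio (v : ℝ≥0) (a : ℝ) : Measurable (gaussRatio v a) := by
  unfold gaussRatio; fun_prop

theorem gaussianReal_eq_withDensity {v : ℝ≥0} (hv : v ≠ 0) (a : ℝ) :
    gaussianReal a v = (gaussianReal 0 v).withDensity (gaussRatio v a) := by
  rw [gaussianReal_of_var_ne_zero _ hv, gaussianReal_of_var_ne_zero _ hv,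
    ← withDensity_mul _ (measurable_gaussianPDF _ _) (measurable_gaussRatio v a)]
  congr 1
  ext z
  have hv' : (v : ℝ) ≠ 0 := by exact_mod_cast hv
  simp only [Pi.mul_apply, gaussianPDF, gaussRatio]
  rw [← ENNReal.ofReal_mul (gaussianPDFReal_nonneg _ _ _)]
  congr 1
  simp only [gaussianPDFReal]
  rw [mul_assoc _ (Real.exp _) (Real.exp _), ← Real.exp_add]
  congr 2
  field_simp
  ring

/-- The chi-square type integral of two Gaussian shifts: the product of the two ratios is a multiple
of the ratio for the shift `a + b`, which integrates to `1`. -/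
theorem lintegral_gaussRatio_mul {v : ℝ≥0} (hv : v ≠ 0) (a b : ℝ) :
    ∫⁻ z, gaussRatio v a z * gaussRatio v b z ∂(gaussianReal 0 v)
      = ENNReal.ofReal (Real.exp (a * b / v)) := by
  have hv' : (v : ℝ) ≠ 0 := by exact_mod_cast hv
  have key : ∀ z, gaussRatio v a z * gaussRatio v b z
      = ENNReal.ofReal (Real.exp (a * b / v)) * gaussRatio v (a + b) z := by
    intro z
    simp only [gaussRatio]
    rw [← ENNReal.ofReal_mul (Real.exp_pos _).le, ← ENNReal.ofReal_mul (Real.exp_pos _).le,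
      ← Real.exp_add, ← Real.exp_add]
    congr 2
    field_simp
    ring
  simp_rw [key]
  rw [lintegral_const_mul _ (measurable_gaussRatio v _)]
  have : ∫⁻ z, gaussRatio v (a + b) z ∂(gaussianReal 0 v) = 1 := by
    rw [← setLIntegral_univ, ← withDensity_apply _ MeasurableSet.univ,
      ← gaussianReal_eq_withDensity hv, measure_univ]
  rw [this, mul_one]

/-- The likelihood ratio of `N(d, v I)` against `N(0, v I)`. -/
noncomputable def gaussRatioPi {n : ℕ} (v : ℝ≥0) (d z : Fin n → ℝ) : ℝ≥0∞ :=
  ∏ i, gaussRatio v (d i) (z i)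

theorem measurable_gaussRatioPi {n : ℕ} (v : ℝ≥0) (d : Fin n → ℝ) :
    Measurable (gaussRatioPi v d) := by
  unfold gaussRatioPi
  exact Finset.measurable_prod _ fun i _ =>
    (measurable_gaussRatio v (d i)).comp (measurable_pi_apply i)

/-- Shifting the Gaussian vector amounts to weighting with the likelihood ratio. -/
theorem lintegral_shift_gaussian {n : ℕ} {v : ℝ≥0} (hv : v ≠ 0) (d : Fin n → ℝ)
    {u : (Fin n → ℝ) → ℝ≥0∞} (hu : Measurable u) :
    ∫⁻ ε, u (fun i => d i + ε i) ∂(Measure.pi fun _ : Fin n => gaussianReal 0 v)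
      = ∫⁻ z, gaussRatioPi v d z * u z ∂(Measure.pi fun _ : Fin n => gaussianReal 0 v) := by
  have hm : ∀ i : Fin n, MeasurePreserving (fun t : ℝ => d i + t) (gaussianReal 0 v)
      (gaussianReal (d i) v) := fun i =>
    ⟨by fun_prop, by simpa using gaussianReal_map_const_add (μ := 0) (v := v) (d i)⟩
  have h1 := (measurePreserving_pi (fun _ : Fin n => gaussianReal 0 v)
    (fun i => gaussianReal (d i) v) hm).lintegral_comp hu
  rw [h1]
  rw [pi_eq_withDensity (fun _ : Fin n => gaussianReal 0 v) (fun i => gaussianReal (d i) v) _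
    (fun i => measurable_gaussRatio v (d i)) fun i => gaussianReal_eq_withDensity hv (d i)]
  exact lintegral_withDensity_eq_lintegral_mul _ (measurable_gaussRatioPi v d) hu

theorem lintegral_gaussRatioPi {n : ℕ} {v : ℝ≥0} (hv : v ≠ 0) (d : Fin n → ℝ) :
    ∫⁻ z, gaussRatioPi v d z ∂(Measure.pi fun _ : Fin n => gaussianReal 0 v) = 1 := by
  have := lintegral_shift_gaussian hv d (u := fun _ => 1) measurable_const
  simpa using this.symm

theorem lintegral_gaussRatioPi_mul {n : ℕ} {v : ℝ≥0} (hv : v ≠ 0) (d e : Fin n → ℝ) :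
    ∫⁻ z, gaussRatioPi v d z * gaussRatioPi v e z
        ∂(Measure.pi fun _ : Fin n => gaussianReal 0 v)
      = ENNReal.ofReal (Real.exp ((∑ i, d i * e i) / v)) := by
  simp_rw [gaussRatioPi, ← Finset.prod_mul_distrib]
  rw [lintegral_pi_prod _ (fun i t => gaussRatio v (d i) t * gaussRatio v (e i) t)
    fun i => (measurable_gaussRatio v _).mul (measurable_gaussRatio v _)]
  simp_rw [lintegral_gaussRatio_mul hv]
  rw [← ENNReal.ofReal_prod_of_nonneg fun i _ => (Real.exp_pos _).le, ← Real.exp_sum,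
    Finset.sum_div]

/-- `S ≤ M min (1, S / M) + S² / (4 M)`, multiplied by `4 M`. -/
theorem four_mul_le_min_add_sq (M S : ℝ≥0∞) (hM : M ≠ ⊤) :
    4 * M * S ≤ 4 * M * min M S + S * S := by
  rcases le_total S M with h | h
  · rw [min_eq_right h]; exact le_self_add
  · rw [min_eq_left h]
    by_cases hS : S = ⊤
    · rcases eq_or_ne M 0 with rfl | hM0
      · simp
      · simp [hS]
    lift M to ℝ≥0 using hM
    lift S to ℝ≥0 using hS
    norm_cast
    rw [← NNReal.coe_le_coe]
    push_cast
    nlinarith [sq_nonneg ((S : ℝ) - 2 * M)]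

/-- Testing a centred Gaussian vector against a uniform mixture of shifted ones: if the chi-square
type sum of the shifts is small, losses with `D ≤ u + v` cannot both have small expectation. -/
theorem gaussian_mixture_test {n : ℕ} {v : ℝ≥0} (hv : v ≠ 0) {ι : Type*} (J : Finset ι)
    (hJ : J.Nonempty) (d : ι → Fin n → ℝ)
    (hd : ∑ j ∈ J, ∑ k ∈ J, Real.exp ((∑ i, d j i * d k i) / v) ≤ 2 * (J.card : ℝ) ^ 2)
    {u w : (Fin n → ℝ) → ℝ≥0∞} (hu : Measurable u) (hw : Measurable w) (D : ℝ≥0∞)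
    (hD : ∀ z, D ≤ u z + w z) :
    J.card * D ≤ 2 * (J.card * (∫⁻ ε, u ε ∂(Measure.pi fun _ : Fin n => gaussianReal 0 v))
      + ∑ j ∈ J, ∫⁻ ε, w (fun i => d j i + ε i)
        ∂(Measure.pi fun _ : Fin n => gaussianReal 0 v)) := by
  set γ := Measure.pi fun _ : Fin n => gaussianReal 0 v with hγ
  set M : ℝ≥0∞ := (J.card : ℝ≥0∞) with hMdef
  have hM0 : M ≠ 0 := by simpa [hMdef] using hJ.ne_empty
  have hMt : M ≠ ⊤ := by simp [hMdef]
  set S : (Fin n → ℝ) → ℝ≥0∞ := fun z => ∑ j ∈ J, gaussRatioPi v (d j) z with hS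
  have hSm : Measurable S := Finset.measurable_sum _ fun j _ => measurable_gaussRatioPi v (d j)
  have hRR : ∀ j k, Measurable fun z => gaussRatioPi v (d j) z * gaussRatioPi v (d k) z :=
    fun j k => (measurable_gaussRatioPi v (d j)).mul (measurable_gaussRatioPi v (d k))
  have hRw : ∀ j, Measurable fun z => gaussRatioPi v (d j) z * w z :=
    fun j => (measurable_gaussRatioPi v (d j)).mul hw
  have hSS : Measurable fun z => S z * S z := hSm.mul hSm
  have hS1 : ∫⁻ z, S z ∂γ = M := by
    rw [lintegral_finsetSum _ fun j _ => measurable_gaussRatioPi v (d j)]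
    simp [hγ, lintegral_gaussRatioPi hv, hMdef]
  have hS2 : ∫⁻ z, S z * S z ∂γ ≤ 2 * M ^ 2 := by
    simp_rw [hS, Finset.sum_mul_sum]
    rw [lintegral_finsetSum _ fun j _ => Finset.measurable_sum _ fun k _ => hRR j k]
    have : ∀ j ∈ J, ∫⁻ z, ∑ k ∈ J, gaussRatioPi v (d j) z * gaussRatioPi v (d k) z ∂γ
        = ENNReal.ofReal (∑ k ∈ J, Real.exp ((∑ i, d j i * d k i) / v)) := by
      intro j _
      rw [lintegral_finsetSum _ fun k _ => hRR j k,
        ENNReal.ofReal_sum_of_nonneg fun k _ => (Real.exp_pos _).le]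
      exact Finset.sum_congr rfl fun k _ => lintegral_gaussRatioPi_mul hv _ _
    rw [Finset.sum_congr rfl this, ← ENNReal.ofReal_sum_of_nonneg
      fun j _ => Finset.sum_nonneg fun k _ => (Real.exp_pos _).le]
    refine (ENNReal.ofReal_le_ofReal hd).trans (le_of_eq ?_)
    rw [ENNReal.ofReal_mul (by norm_num), ENNReal.ofReal_pow (by positivity)]
    simp [hMdef]
  have hmin : M ≤ 2 * ∫⁻ z, min M (S z) ∂γ := by
    have h1 : ∫⁻ z, 4 * M * S z ∂γ ≤ ∫⁻ z, (4 * M * min M (S z) + S z * S z) ∂γ :=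
      lintegral_mono fun z => four_mul_le_min_add_sq M (S z) hMt
    rw [lintegral_const_mul _ hSm, lintegral_add_right _ hSS,
      lintegral_const_mul _ (measurable_const.min hSm), hS1] at h1
    have h2 := h1.trans (add_le_add_right hS2 _)
    have hI : ∫⁻ z, min M (S z) ∂γ ≠ ⊤ := by
      refine ne_top_of_le_ne_top hMt ((lintegral_mono fun z => min_le_right _ _).trans hS1.le)
    generalize ∫⁻ z, min M (S z) ∂γ = I at *
    lift I to ℝ≥0 using hI
    generalize M = M' at *
    lift M' to ℝ≥0 using hMt
    norm_cast at h2 hM0 ⊢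
    rw [← NNReal.coe_le_coe] at h2 ⊢
    push_cast at h2 ⊢
    have hpos : (0 : ℝ) < M' := by positivity
    nlinarith
  have hw' : ∀ j ∈ J, ∫⁻ ε, w (fun i => d j i + ε i) ∂γ = ∫⁻ z, gaussRatioPi v (d j) z * w z ∂γ :=
    fun j _ => lintegral_shift_gaussian hv (d j) hw
  rw [Finset.sum_congr rfl hw', ← lintegral_finsetSum _ fun j _ => hRw j, ← lintegral_const_mul _ hu,
    ← lintegral_add_left (hu.const_mul M)]
  calc M * D ≤ 2 * (∫⁻ z, min M (S z) ∂γ) * D := by gcongr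
    _ = 2 * ∫⁻ z, min M (S z) * D ∂γ := by
      rw [lintegral_mul_const _ (measurable_const.min hSm), mul_assoc]
    _ ≤ _ := by
      gcongr with z
      rw [← Finset.sum_mul]
      calc min M (S z) * D ≤ min M (S z) * (u z + w z) := by gcongr; exact hD z
        _ = min M (S z) * u z + min M (S z) * w z := mul_add _ _ _
        _ ≤ M * u z + S z * w z := by
          gcongr
          · exact min_le_left _ _
          · exact min_le_right _ _

/-! ### Bump functions in the Sobolev class -/

/-- Classical derivatives of a `C²` function are weak derivatives. -/
theorem hasWeakDeriv_of_hasDerivAt {f f' : ℝ → ℝ} (h : ∀ t, HasDerivAt f (f' t) t)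
    (hc : Continuous f') : HasWeakDeriv f f' := by
  intro φ hφ _ hsupp
  have h0 : φ 0 = 0 := by
    by_contra hne
    exact lt_irrefl _ (hsupp (subset_tsupport _ hne)).1
  have h1 : φ 1 = 0 := by
    by_contra hne
    exact lt_irrefl _ (hsupp (subset_tsupport _ hne)).2
  have hd : ∀ t, HasDerivAt φ (deriv φ t) t := fun t =>
    (hφ.differentiable (by simp) t).hasDerivAt
  have hdc : Continuous (deriv φ) := hφ.continuous_deriv (by simp)
  have := intervalIntegral.integral_mul_deriv_eq_deriv_mul (a := 0) (b := 1)
    (fun t _ => h t) (fun t _ => hd t) (hc.intervalIntegrable _ _) (hdc.intervalIntegrable _ _)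
  rw [h0, h1, intervalIntegral.integral_of_le zero_le_one,
    intervalIntegral.integral_of_le zero_le_one, integral_Ioc_eq_integral_Ioo,
    integral_Ioc_eq_integral_Ioo] at this
  simpa using this

theorem memLp_Ioo_of_continuous {f : ℝ → ℝ} (hf : Continuous f) :
    MemLp f 2 (volume.restrict (Ioo 0 1)) := by
  obtain ⟨C, hC⟩ := (isCompact_Icc (a := (0 : ℝ)) (b := 1)).exists_bound_of_continuousOn
    hf.continuousOn
  refine MemLp.of_bound hf.aestronglyMeasurable C ?_
  filter_upwards [ae_restrict_mem measurableSet_Ioo] with t ht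
  exact hC t (Ioo_subset_Icc_self ht)

theorem isSobolevTwo_of_hasDerivAt {f f₁ f₂ : ℝ → ℝ} (h₁ : ∀ t, HasDerivAt f (f₁ t) t)
    (h₂ : ∀ t, HasDerivAt f₁ (f₂ t) t) (hc : Continuous f₂) : IsSobolevTwo f f₁ f₂ := by
  have c0 : Continuous f := continuous_iff_continuousAt.2 fun t => (h₁ t).continuousAt
  have c1 : Continuous f₁ := continuous_iff_continuousAt.2 fun t => (h₂ t).continuousAt
  exact ⟨c0.continuousOn, memLp_Ioo_of_continuous c0, memLp_Ioo_of_continuous c1,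
    memLp_Ioo_of_continuous hc, hasWeakDeriv_of_hasDerivAt h₁ c1, hasWeakDeriv_of_hasDerivAt h₂ hc⟩

/-- A smooth bump on `(0, 1)`, equal to `1` on the middle half. -/
noncomputable def kernelBump : ContDiffBump (1 / 2 : ℝ) :=
  ⟨1 / 4, 3 / 8, by norm_num, by norm_num⟩

/-- The bump function underlying all the perturbations. -/
noncomputable def kern (t : ℝ) : ℝ := kernelBump t

theorem kern_contDiff : ContDiff ℝ ∞ kern := kernelBump.contDiff

theorem kern_nonneg (t : ℝ) : 0 ≤ kern t := kernelBump.nonneg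

theorem kern_le_one (t : ℝ) : kern t ≤ 1 := kernelBump.le_one

theorem kern_eq_one {t : ℝ} (ht : t ∈ Icc (1 / 4 : ℝ) (3 / 4)) : kern t = 1 := by
  refine kernelBump.one_of_mem_closedBall ?_
  rw [Real.closedBall_eq_Icc]
  refine ⟨le_trans ?_ ht.1, le_trans ht.2 ?_⟩ <;> norm_num [kernelBump]

theorem tsupport_kern : tsupport kern ⊆ Ioo 0 1 := by
  have : tsupport kern = Metric.closedBall (1 / 2) (3 / 8) := kernelBump.tsupport_eq
  rw [this, Real.closedBall_eq_Icc]
  rintro t ⟨h1, h2⟩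
  constructor <;> linarith

theorem kern_eq_zero {t : ℝ} (ht : t ∉ Ioo (0 : ℝ) 1) : kern t = 0 :=
  image_eq_zero_of_notMem_tsupport fun h => ht (tsupport_kern h)

theorem deriv2_kern_eq_zero {t : ℝ} (ht : t ∉ Ioo (0 : ℝ) 1) : deriv (deriv kern) t = 0 :=
  image_eq_zero_of_notMem_tsupport fun h =>
    ht (tsupport_kern (tsupport_deriv_subset (𝕜 := ℝ) (tsupport_deriv_subset (𝕜 := ℝ) h)))

theorem hasDerivAt_kern (t : ℝ) : HasDerivAt kern (deriv kern t) t :=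
  (kern_contDiff.differentiable (by simp) t).hasDerivAt

theorem contDiff_deriv_kern : ContDiff ℝ ∞ (deriv kern) :=
  (contDiff_infty_iff_deriv.1 kern_contDiff).2

theorem hasDerivAt_deriv_kern (t : ℝ) : HasDerivAt (deriv kern) (deriv (deriv kern) t) t :=
  (contDiff_deriv_kern.differentiable (by simp) t).hasDerivAt

theorem continuous_deriv2_kern : Continuous (deriv (deriv kern)) :=
  contDiff_deriv_kern.continuous_deriv (by simp)

theorem exists_deriv2_kern_bound : ∃ C : ℝ, 0 < C ∧ ∀ t, |deriv (deriv kern) t| ≤ C := by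
  obtain ⟨C, hC⟩ := (isCompact_Icc (a := (0 : ℝ)) (b := 1)).exists_bound_of_continuousOn
    continuous_deriv2_kern.continuousOn
  refine ⟨max C 1, by positivity, fun t => ?_⟩
  by_cases ht : t ∈ Ioo (0 : ℝ) 1
  · exact (hC t (Ioo_subset_Icc_self ht)).trans (le_max_left _ _)
  · rw [deriv2_kern_eq_zero ht]; simp

/-- `A ∑_{k ∈ S} g (m t - k)`: copies of `g`, shrunk to the cells `(k / m, (k + 1) / m)`. -/
noncomputable def cellSum (g : ℝ → ℝ) (A : ℝ) {m : ℕ} (S : Finset (Fin m)) (t : ℝ) : ℝ :=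
  A * ∑ k ∈ S, g (m * t - (k : ℕ))

theorem cell_unique {m : ℕ} {k l : Fin m} {s : ℝ} (hk : s - (k : ℕ) ∈ Ioo (0 : ℝ) 1)
    (hl : s - (l : ℕ) ∈ Ioo (0 : ℝ) 1) : k = l := by
  have h1 : ((k : ℕ) : ℝ) < (l : ℕ) + 1 := by linarith [hk.1, hl.2]
  have h2 : ((l : ℕ) : ℝ) < (k : ℕ) + 1 := by linarith [hl.1, hk.2]
  norm_cast at h1 h2
  exact Fin.ext (by omega)

theorem cellSum_of_mem {g : ℝ → ℝ} (hg : ∀ t ∉ Ioo (0 : ℝ) 1, g t = 0) (A : ℝ) {m : ℕ}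
    {S : Finset (Fin m)} {t : ℝ} {k : Fin m} (hkS : k ∈ S)
    (hk : m * t - (k : ℕ) ∈ Ioo (0 : ℝ) 1) : cellSum g A S t = A * g (m * t - (k : ℕ)) := by
  unfold cellSum
  rw [Finset.sum_eq_single_of_mem k hkS fun l _ hl => hg _ fun h => hl (cell_unique h hk)]

theorem cellSum_of_forall_notMem {g : ℝ → ℝ} (hg : ∀ t ∉ Ioo (0 : ℝ) 1, g t = 0) (A : ℝ) {m : ℕ}
    {S : Finset (Fin m)} {t : ℝ}
    (h : ∀ k ∈ S, (m : ℝ) * t - (k : ℕ) ∉ Ioo (0 : ℝ) 1) : cellSum g A S t = 0 := by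
  unfold cellSum
  rw [Finset.sum_eq_zero fun k hk => hg _ (h k hk), mul_zero]

theorem abs_cellSum_le {g : ℝ → ℝ} (hg : ∀ t ∉ Ioo (0 : ℝ) 1, g t = 0) {A B : ℝ} (hA : 0 ≤ A)
    (hB : 0 ≤ B) (hgB : ∀ t, |g t| ≤ B) {m : ℕ} (S : Finset (Fin m)) (t : ℝ) :
    |cellSum g A S t| ≤ A * B := by
  by_cases h : ∃ k ∈ S, (m : ℝ) * t - (k : ℕ) ∈ Ioo (0 : ℝ) 1
  · obtain ⟨k, hkS, hk⟩ := h
    rw [cellSum_of_mem hg A hkS hk, abs_mul, abs_of_nonneg hA]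
    gcongr
    exact hgB _
  · push Not at h
    rw [cellSum_of_forall_notMem hg A h, abs_zero]
    positivity

theorem hasDerivAt_cellSum {g g' : ℝ → ℝ} (h : ∀ t, HasDerivAt g (g' t) t) (A : ℝ) {m : ℕ}
    (S : Finset (Fin m)) (t : ℝ) :
    HasDerivAt (cellSum g A S) (cellSum g' (A * m) S t) t := by
  have h1 : ∀ k ∈ S, HasDerivAt (fun t : ℝ => g (m * t - (k : ℕ)))
      (g' (m * t - (k : ℕ)) * m) t := fun k _ => by
    have hl : HasDerivAt (fun t : ℝ => (m : ℝ) * t - (k : ℕ)) m t := by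
      simpa using ((hasDerivAt_id t).const_mul (m : ℝ)).sub_const ((k : ℕ) : ℝ)
    exact (h _).comp t hl
  have h2 := (HasDerivAt.fun_sum h1).const_mul A
  unfold cellSum
  refine h2.congr_deriv ?_
  rw [← Finset.sum_mul]; ring

theorem continuous_cellSum {g : ℝ → ℝ} (hg : Continuous g) (A : ℝ) {m : ℕ}
    (S : Finset (Fin m)) : Continuous (cellSum g A S) := by
  unfold cellSum
  fun_prop

theorem lintegral_cellSum_sq_le {g : ℝ → ℝ} (hg : ∀ t ∉ Ioo (0 : ℝ) 1, g t = 0) {A B : ℝ}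
    (hA : 0 ≤ A) (hB : 0 ≤ B) (hgB : ∀ t, |g t| ≤ B) {m : ℕ} (hm : 0 < m) (S : Finset (Fin m)) :
    ∫⁻ t in Ioo (0 : ℝ) 1, ‖cellSum g A S t‖ₑ ^ 2 ≤
      ENNReal.ofReal ((A * B) ^ 2 * S.card / m) := by
  have hm' : (0 : ℝ) < m := by exact_mod_cast hm
  set I : Fin m → Set ℝ := fun k => Ioo ((k : ℕ) / m : ℝ) (((k : ℕ) + 1) / m)
  -- At most one summand is nonzero at each point, so the square is bounded by cell indicators.
  have hpt : ∀ t, ‖cellSum g A S t‖ₑ ^ 2 ≤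
      ∑ k ∈ S, (I k).indicator (fun _ => ENNReal.ofReal ((A * B) ^ 2)) t := by
    intro t
    by_cases h : ∃ k ∈ S, (m : ℝ) * t - (k : ℕ) ∈ Ioo (0 : ℝ) 1
    · obtain ⟨k, hkS, hk⟩ := h
      have htI : t ∈ I k := by
        constructor
        · rw [div_lt_iff₀ hm']; linarith [hk.1]
        · rw [lt_div_iff₀ hm']; linarith [hk.2]
      refine le_trans ?_ (Finset.single_le_sum (f := fun k => (I k).indicator
        (fun _ => ENNReal.ofReal ((A * B) ^ 2)) t) (fun _ _ => zero_le) hkS)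
      simp only [indicator_of_mem htI]
      rw [ENNReal.ofReal_pow (by positivity), Real.enorm_eq_ofReal_abs]
      gcongr
      exact abs_cellSum_le hg hA hB hgB S t
    · push Not at h
      rw [cellSum_of_forall_notMem hg A h]
      simp
  calc _ ≤ ∫⁻ t, ∑ k ∈ S, (I k).indicator (fun _ => ENNReal.ofReal ((A * B) ^ 2)) t :=
        (setLIntegral_le_lintegral _ _).trans (lintegral_mono hpt)
    _ = ∑ k ∈ S, ENNReal.ofReal ((A * B) ^ 2) * ENNReal.ofReal (1 / m) := by
        rw [lintegral_finsetSum _ fun k _ => measurable_const.indicator measurableSet_Ioo]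
        refine Finset.sum_congr rfl fun k _ => ?_
        rw [lintegral_indicator measurableSet_Ioo, setLIntegral_const, Real.volume_Ioo]
        congr 2
        field_simp
        ring
    _ = _ := by
        rw [Finset.sum_const, nsmul_eq_mul, ← ENNReal.ofReal_mul (by positivity),
          ← ENNReal.ofReal_natCast, ← ENNReal.ofReal_mul (by positivity)]
        congr 1
        ring

/-- The bumps have disjoint supports, so their number enters the curvature only through `|S| / m`,
the length of the cells that carry a bump. -/
theorem cellSum_kern_mem_sobolevClass {C : ℝ} (hC : 0 < C)
    (hK : ∀ t, |deriv (deriv kern) t| ≤ C) {m₁ L : ℝ≥0∞} {A : ℝ} (hA : 0 ≤ A) {m : ℕ}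
    (hm : 0 < m) (S : Finset (Fin m)) (h₁ : ENNReal.ofReal A ≤ m₁)
    (h₂ : ENNReal.ofReal ((A * m ^ 2 * C) ^ 2 * S.card / m) ≤ L) :
    cellSum kern A S ∈ sobolevClass m₁ L := by
  refine ⟨cellSum (deriv kern) (A * m) S, cellSum (deriv (deriv kern)) (A * m * m) S,
    isSobolevTwo_of_hasDerivAt (hasDerivAt_cellSum hasDerivAt_kern A S)
      (hasDerivAt_cellSum hasDerivAt_deriv_kern _ S)
      (continuous_cellSum continuous_deriv2_kern _ S), fun t _ => ?_, ?_⟩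
  · refine le_trans ?_ h₁
    rw [Real.enorm_eq_ofReal_abs]
    refine ENNReal.ofReal_le_ofReal ?_
    simpa using abs_cellSum_le (fun t ht => kern_eq_zero ht) hA zero_le_one
      (fun t => abs_le.2 ⟨by linarith [kern_nonneg t], kern_le_one t⟩) S t
  · refine le_trans ?_ h₂
    have := lintegral_cellSum_sq_le (fun t ht => deriv2_kern_eq_zero ht) (A := A * m * m)
      (by positivity) hC.le hK hm S
    rwa [show A * m * m * C = A * m ^ 2 * C by ring] at this

theorem continuous_cellSum_kern (A : ℝ) {m : ℕ} (S : Finset (Fin m)) :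
    Continuous (cellSum kern A S) :=
  continuous_cellSum kern_contDiff.continuous A S

/-- Switching one bump on or off changes the function by exactly that bump. -/
theorem abs_cellSum_symmDiff_sub (g : ℝ → ℝ) (A : ℝ) {m : ℕ} (S : Finset (Fin m)) (k : Fin m)
    (t : ℝ) : |cellSum g A (symmDiff S {k}) t - cellSum g A S t| = |A * g (m * t - (k : ℕ))| := by
  classical
  unfold cellSum
  by_cases hk : k ∈ S
  · have h1 : symmDiff S {k} = S.erase k := by
      ext l; simp only [Finset.mem_symmDiff, Finset.mem_singleton, Finset.mem_erase]; grind
    rw [h1, ← Finset.add_sum_erase S _ hk, abs_sub_comm]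
    congr 1; ring
  · have h1 : symmDiff S {k} = insert k S := by
      ext l; simp only [Finset.mem_symmDiff, Finset.mem_singleton, Finset.mem_insert]; grind
    rw [h1, Finset.sum_insert hk]
    congr 1; ring

/-- The cells that contain at most twice the average number of design points. -/
noncomputable def sparseCells {n : ℕ} (x : Fin n → ℝ) (m : ℕ) : Finset (Fin m) :=
  open Classical in
  {k : Fin m | (Finset.univ.filter fun i => m * x i - (k : ℕ) ∈ Ioo (0 : ℝ) 1).card * m ≤ 2 * n}

/-- At least half of the cells are sparse, since each design point lies in at most one cell. -/
theorem le_two_mul_card_sparseCells {n : ℕ} (hn : 0 < n) (x : Fin n → ℝ) (m : ℕ) :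
    m ≤ 2 * (sparseCells x m).card := by
  classical
  set N : Fin m → Finset (Fin n) :=
    fun k => Finset.univ.filter fun i => m * x i - (k : ℕ) ∈ Ioo (0 : ℝ) 1 with hN
  have hsum : ∑ k, (N k).card ≤ n := by
    have hdis : ((Finset.univ : Finset (Fin m)) : Set (Fin m)).PairwiseDisjoint N := by
      intro k _ l _ hkl
      rw [Function.onFun, Finset.disjoint_left]
      intro i hi hi'
      simp only [hN, Finset.mem_filter_univ] at hi hi'
      exact hkl (cell_unique hi hi')
    rw [← Finset.card_biUnion hdis]
    simpa using Finset.card_le_univ (Finset.univ.biUnion N)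
  have hcompl : (sparseCells x m)ᶜ.card * (2 * n) ≤ n * m := by
    calc (sparseCells x m)ᶜ.card * (2 * n) = ∑ k ∈ (sparseCells x m)ᶜ, 2 * n := by simp
      _ ≤ ∑ k ∈ (sparseCells x m)ᶜ, (N k).card * m := by
        refine Finset.sum_le_sum fun k hk => ?_
        simp only [sparseCells, Finset.compl_filter, Finset.mem_filter_univ, not_le] at hk
        exact hk.le
      _ ≤ ∑ k, (N k).card * m := Finset.sum_le_univ_sum_of_nonneg fun _ => Nat.zero_le _
      _ ≤ n * m := by rw [← Finset.sum_mul]; gcongr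
  have h2 : (sparseCells x m)ᶜ.card * 2 ≤ m := by
    refine Nat.le_of_mul_le_mul_left ?_ hn
    linarith
  have h3 := Finset.card_add_card_compl (sparseCells x m)
  rw [Fintype.card_fin] at h3
  omega

/-- On a sparse cell, the empirical energy of a bump of height `A` is at most `2 A² n / m`. -/
theorem sum_sq_kern_le {n : ℕ} {x : Fin n → ℝ} {m : ℕ} (hm : 0 < m) {k : Fin m}
    (hk : k ∈ sparseCells x m) (A : ℝ) :
    ∑ i, (A * kern (m * x i - (k : ℕ))) ^ 2 ≤ A ^ 2 * (2 * n / m) := by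
  classical
  have hm' : (0 : ℝ) < m := by exact_mod_cast hm
  simp only [sparseCells, Finset.mem_filter_univ] at hk
  calc ∑ i, (A * kern (m * x i - (k : ℕ))) ^ 2
      ≤ ∑ i, if m * x i - (k : ℕ) ∈ Ioo (0 : ℝ) 1 then A ^ 2 else 0 := by
        refine Finset.sum_le_sum fun i _ => ?_
        split_ifs with h
        · rw [mul_pow]
          exact mul_le_of_le_one_right (sq_nonneg _)
            (pow_le_one₀ (kern_nonneg _) (kern_le_one _))
        · simp [kern_eq_zero h]
    _ = A ^ 2 * (Finset.univ.filter fun i => m * x i - (k : ℕ) ∈ Ioo (0 : ℝ) 1).card := by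
        rw [← Finset.sum_filter, Finset.sum_const, nsmul_eq_mul, mul_comm]
    _ ≤ _ := by
        gcongr
        rw [le_div_iff₀ hm']
        exact_mod_cast hk

/-! ### The squared `L²` loss without corruption -/

/-- Without any corruption the adversary produces the clean data, so the risk dominates the
classical one. -/
theorem lintegral_clean_le_risk (loss : (ℝ → ℝ) → (ℝ → ℝ) → ℝ≥0∞) {n : ℕ} (x : Fin n → ℝ) (q : ℕ)
    (m₂ : ℝ≥0∞) (μ : Measure ℝ) (f : ℝ → ℝ) (fhat : (Fin n → ℝ) → ℝ → ℝ) :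
    ∫⁻ ε, loss f (fhat fun i => f (x i) + ε i) ∂(Measure.pi fun _ : Fin n => μ) ≤
      risk loss x q m₂ μ f fhat := by
  refine lintegral_mono fun ε => ?_
  exact le_iSup₂_of_le (f := fun y _ => loss f (fhat y)) (fun i => f (x i) + ε i)
    ⟨∅, by simp, by simp, by simp⟩ le_rfl

/-- To bound the minimax risk from below, bound every uniform upper bound `R` of the risks of an
arbitrary estimator. -/
theorem le_minimaxRisk {loss : (ℝ → ℝ) → (ℝ → ℝ) → ℝ≥0∞} {σ : ℝ} {m₁ L m₂ : ℝ≥0∞} {n : ℕ}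
    {x : Fin n → ℝ} {q : ℕ} {B : ℝ≥0∞}
    (h : ∀ fhat : (Fin n → ℝ) → ℝ → ℝ, (Measurable fun p : (Fin n → ℝ) × ℝ => fhat p.1 p.2) →
      ∀ R : ℝ≥0∞, (∀ f ∈ sobolevClass m₁ L, ∀ μ ∈ noiseLaws σ, risk loss x q m₂ μ f fhat ≤ R) →
        B ≤ R) : B ≤ minimaxRisk loss σ m₁ L m₂ x q :=
  le_iInf₂ fun fhat hfhat => h fhat hfhat _ fun f hf μ hμ =>
    le_iSup₂_of_le (f := fun f _ => ⨆ μ ∈ noiseLaws σ, risk loss x q m₂ μ f fhat) f hf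
      (le_iSup₂_of_le (f := fun μ _ => risk loss x q m₂ μ f fhat) μ hμ le_rfl)

theorem gaussianReal_mem_noiseLaws {σ : ℝ} (hσ : 0 < σ) :
    gaussianReal 0 (σ ^ 2).toNNReal ∈ noiseLaws σ := by
  have hv : (σ ^ 2).toNNReal ≠ 0 := by
    rw [Ne, Real.toNNReal_eq_zero, not_le]; positivity
  refine ⟨inferInstance, gaussianReal_absolutelyContinuous 0 hv, ?_, integral_id_gaussianReal, ?_⟩
  · exact memLp_id_gaussianReal 2
  · rw [variance_id_gaussianReal, Real.coe_toNNReal _ (sq_nonneg σ)]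

/-- Two values at distance `|D|` cannot both be close to `c`. -/
theorem half_sq_le_enorm_sq_add {a b c D : ℝ} (h : |b - a| = |D|) :
    ENNReal.ofReal (D ^ 2 / 2) ≤ ‖a - c‖ₑ ^ 2 + ‖b - c‖ₑ ^ 2 := by
  rw [← enorm_pow, ← enorm_pow, Real.enorm_of_nonneg (sq_nonneg _),
    Real.enorm_of_nonneg (sq_nonneg _), ← ENNReal.ofReal_add (sq_nonneg _) (sq_nonneg _)]
  refine ENNReal.ofReal_le_ofReal ?_
  have := sq_eq_sq_iff_abs_eq_abs (b - a) D |>.2 h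
  nlinarith [sq_nonneg (a - c + (b - c))]

/-- The middle half of the `k`-th of `m` cells of `[0, 1]`, on which the bump is constant. -/
def midCell {m : ℕ} (k : Fin m) : Set ℝ :=
  Icc (((k : ℕ) + 1 / 4) / m : ℝ) (((k : ℕ) + 3 / 4) / m)

theorem mul_sub_mem_of_mem_midCell {m : ℕ} {k : Fin m} {t : ℝ} (ht : t ∈ midCell k) :
    m * t - (k : ℕ) ∈ Icc (1 / 4 : ℝ) (3 / 4) := by
  have hm : (0 : ℝ) < m := by exact_mod_cast k.pos
  obtain ⟨h1, h2⟩ := ht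
  rw [div_le_iff₀ hm] at h1
  rw [le_div_iff₀ hm] at h2
  constructor <;> linarith

theorem midCell_subset {m : ℕ} (k : Fin m) : midCell k ⊆ Icc 0 1 := by
  intro t ht
  have hm : (0 : ℝ) < m := by exact_mod_cast k.pos
  obtain ⟨h1, h2⟩ := mul_sub_mem_of_mem_midCell ht
  have h3 : ((k : ℕ) : ℝ) + 1 ≤ m := by exact_mod_cast k.2
  have h4 : (0 : ℝ) ≤ (k : ℕ) := by positivity
  constructor
  · by_contra h
    nlinarith
  · by_contra h
    nlinarith

theorem volume_midCell {m : ℕ} (k : Fin m) :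
    volume (midCell k) = ENNReal.ofReal (1 / (2 * m)) := by
  have hm : (0 : ℝ) < m := by exact_mod_cast k.pos
  rw [midCell, Real.volume_Icc]
  congr 1
  field_simp
  norm_num

theorem disjoint_midCell {m : ℕ} {k l : Fin m} (h : k ≠ l) : Disjoint (midCell k) (midCell l) := by
  rw [Set.disjoint_left]
  intro t hk hl
  have h1 := mul_sub_mem_of_mem_midCell hk
  have h2 := mul_sub_mem_of_mem_midCell hl
  exact h (cell_unique (s := m * t) ⟨by linarith [h1.1], by linarith [h1.2]⟩
    ⟨by linarith [h2.1], by linarith [h2.2]⟩)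

/-- The part of the squared `L²` loss that comes from the middle of the `k`-th cell. -/
noncomputable def midLoss {m : ℕ} (k : Fin m) (f g : ℝ → ℝ) : ℝ≥0∞ :=
  ∫⁻ t in midCell k, ‖f t - g t‖ₑ ^ 2

theorem sum_midLoss_le {m : ℕ} (G : Finset (Fin m)) (f g : ℝ → ℝ) :
    ∑ k ∈ G, midLoss k f g ≤ lossTwo f g := by
  unfold midLoss lossTwo
  rw [← lintegral_biUnion_finset (fun k _ l _ h => disjoint_midCell h)
    (fun k _ => measurableSet_Icc)]
  exact lintegral_mono_set (iUnion₂_subset fun k _ => midCell_subset k)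

/-- No function is close on the `k`-th cell to both of two bump sums that differ in the `k`-th
bump. -/
theorem le_midLoss_add {A : ℝ} {m : ℕ} (S : Finset (Fin m)) (k : Fin m) {g : ℝ → ℝ}
    (hg : Measurable g) :
    ENNReal.ofReal (A ^ 2 / (4 * m)) ≤
      midLoss k (cellSum kern A S) g + midLoss k (cellSum kern A (symmDiff S {k})) g := by
  have hm : (0 : ℝ) < m := by exact_mod_cast k.pos
  have hmeas : Measurable fun t => ‖cellSum kern A S t - g t‖ₑ ^ 2 := by
    have := (continuous_cellSum_kern A S).measurable
    fun_prop
  unfold midLoss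
  rw [← lintegral_add_left hmeas]
  calc ENNReal.ofReal (A ^ 2 / (4 * m)) = ∫⁻ t in midCell k, ENNReal.ofReal (A ^ 2 / 2) := by
        rw [setLIntegral_const, volume_midCell, ← ENNReal.ofReal_mul (by positivity)]
        congr 1
        field_simp
        norm_num
    _ ≤ _ := by
        refine setLIntegral_mono' measurableSet_Icc fun t ht => ?_
        refine half_sq_le_enorm_sq_add ?_
        rw [abs_cellSum_symmDiff_sub, kern_eq_one (mul_sub_mem_of_mem_midCell ht), mul_one]

theorem measurable_midLoss {n m : ℕ} (k : Fin m) {f : ℝ → ℝ} (hf : Measurable f)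
    {fhat : (Fin n → ℝ) → ℝ → ℝ} (h : Measurable fun p : (Fin n → ℝ) × ℝ => fhat p.1 p.2)
    (θ : Fin n → ℝ) :
    Measurable fun ε : Fin n → ℝ => midLoss k f (fhat fun i => θ i + ε i) := by
  unfold midLoss
  refine Measurable.lintegral_prod_right'
    (f := fun p : (Fin n → ℝ) × ℝ => ‖f p.2 - fhat (fun i => θ i + p.1 i) p.2‖ₑ ^ 2) ?_
  have h1 : Measurable fun p : (Fin n → ℝ) × ℝ => fhat (fun i => θ i + p.1 i) p.2 :=
    h.comp (g := fun p : (Fin n → ℝ) × ℝ => fhat p.1 p.2)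
      (f := fun p : (Fin n → ℝ) × ℝ => ((fun i => θ i + p.1 i), p.2)) (by fun_prop)
  fun_prop

/-- Assouad's argument over all subsets of the `m` bumps of height `A`. -/
theorem minimaxRisk_lossTwo_ge_bumps {σ : ℝ} (hσ : 0 < σ) {m₁ L m₂ : ℝ≥0∞} {n m : ℕ} (hn : 0 < n)
    (hm : 0 < m) {A : ℝ} (hclass : ∀ S : Finset (Fin m), cellSum kern A S ∈ sobolevClass m₁ L)
    (hA : Real.exp (A ^ 2 * (2 * n / m) / σ ^ 2) ≤ 2) (x : Fin n → ℝ) (q : ℕ) :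
    ENNReal.ofReal (A ^ 2 / 32) ≤ minimaxRisk lossTwo σ m₁ L m₂ x q := by
  classical
  refine le_minimaxRisk fun fhat hfhat R hR => ?_
  have hm' : (0 : ℝ) < m := by exact_mod_cast hm
  set v : ℝ≥0 := (σ ^ 2).toNNReal with hvdef
  have hvc : (v : ℝ) = σ ^ 2 := Real.coe_toNNReal _ (sq_nonneg σ)
  have hv : v ≠ 0 := by
    rw [hvdef, Ne, Real.toNNReal_eq_zero, not_le]; positivity
  set γ := Measure.pi fun _ : Fin n => gaussianReal 0 v with hγ
  set F : Finset (Fin m) → ℝ → ℝ := fun S => cellSum kern A S with hF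
  have hFm : ∀ S, Measurable (F S) := fun S => (continuous_cellSum_kern A S).measurable
  set G := sparseCells x m
  set D := ENNReal.ofReal (A ^ 2 / (4 * m)) with hD
  set E : Fin m → Finset (Fin m) → ℝ≥0∞ := fun k S =>
    ∫⁻ ε, midLoss k (F S) (fhat fun i => F S (x i) + ε i) ∂γ with hE
  have hsumE : ∀ S, ∑ k ∈ G, E k S ≤ R := by
    intro S
    rw [hE, ← lintegral_finsetSum _ fun k _ => measurable_midLoss k (hFm S) hfhat _]
    refine le_trans ?_ (hR (F S) (hclass S) _ (gaussianReal_mem_noiseLaws hσ))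
    exact (lintegral_mono fun ε => sum_midLoss_le G _ _).trans (lintegral_clean_le_risk _ _ _ _ _ _ _)
  -- Switching the bump on a sparse cell cannot be detected reliably.
  have hpair : ∀ k ∈ G, ∀ S, D ≤ 2 * (E k S + E k (symmDiff S {k})) := by
    intro k hk S
    have := gaussian_mixture_test hv (J := ({()} : Finset Unit)) (by simp)
      (fun _ i => F (symmDiff S {k}) (x i) - F S (x i)) ?_
      (u := fun ε => midLoss k (F S) (fhat fun i => F S (x i) + ε i))
      (w := fun ε => midLoss k (F (symmDiff S {k})) (fhat fun i => F S (x i) + ε i))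
      (measurable_midLoss k (hFm _) hfhat _) (measurable_midLoss k (hFm _) hfhat _) D ?_
    · simpa only [Finset.card_singleton, Nat.cast_one, one_mul, Finset.sum_singleton,
        ← add_assoc, add_sub_cancel] using this
    · simp only [Finset.card_singleton, Finset.sum_singleton, hvc, Nat.cast_one, one_pow, mul_one]
      refine le_trans (Real.exp_le_exp.2 ?_) hA
      gcongr
      refine le_trans (le_of_eq ?_) (sum_sq_kern_le hm hk A)
      refine Finset.sum_congr rfl fun i _ => ?_
      rw [← sq, ← sq_abs, hF, abs_cellSum_symmDiff_sub, sq_abs]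
    · intro z
      exact le_midLoss_add S k (hfhat.comp measurable_prodMk_left)
  -- Summing over all `S` and using that switching is a bijection.
  have hsumS : ∀ k ∈ G, (2 : ℝ≥0∞) ^ m * D ≤ 4 * ∑ S, E k S := by
    intro k hk
    have hinv : ∑ S, E k (symmDiff S {k}) = ∑ S, E k S :=
      Equiv.sum_comp (symmDiff_left_involutive ({k} : Finset (Fin m))).toPerm (E k)
    calc (2 : ℝ≥0∞) ^ m * D = ∑ _S : Finset (Fin m), D := by simp
      _ ≤ ∑ S, 2 * (E k S + E k (symmDiff S {k})) := Finset.sum_le_sum fun S _ => hpair k hk S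
      _ = 4 * ∑ S, E k S := by
        rw [← Finset.mul_sum, Finset.sum_add_distrib, hinv]; ring
  have htot : (2 : ℝ≥0∞) ^ m * (G.card * D) ≤ 2 ^ m * (4 * R) := by
    calc (2 : ℝ≥0∞) ^ m * (G.card * D) = ∑ k ∈ G, 2 ^ m * D := by
          rw [Finset.sum_const, nsmul_eq_mul]; ring
      _ ≤ ∑ k ∈ G, 4 * ∑ S, E k S := Finset.sum_le_sum hsumS
      _ = 4 * ∑ S, ∑ k ∈ G, E k S := by rw [← Finset.mul_sum, Finset.sum_comm]
      _ ≤ 4 * ∑ _S : Finset (Fin m), R := by gcongr with S; exact hsumE S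
      _ = 2 ^ m * (4 * R) := by simp; ring
  have hGR : G.card * D ≤ 4 * R :=
    (ENNReal.mul_le_mul_iff_right (by simp) (by finiteness)).1 htot
  have hcard : (m : ℝ) ≤ 2 * G.card := by exact_mod_cast le_two_mul_card_sparseCells hn x m
  have hfin : ENNReal.ofReal 4 * ENNReal.ofReal (A ^ 2 / 32) ≤ G.card * D := by
    rw [hD, ← ENNReal.ofReal_natCast, ← ENNReal.ofReal_mul (by positivity),
      ← ENNReal.ofReal_mul (by positivity)]
    refine ENNReal.ofReal_le_ofReal ?_
    rw [← sub_nonneg]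
    have : (G.card : ℝ) * (A ^ 2 / (4 * m)) - 4 * (A ^ 2 / 32)
        = A ^ 2 * (2 * G.card - m) / (8 * m) := by field_simp; ring
    rw [this]
    exact div_nonneg (mul_nonneg (sq_nonneg _) (by linarith)) (by positivity)
  have := hfin.trans hGR
  rw [ENNReal.ofReal_ofNat] at this
  exact (ENNReal.mul_le_mul_iff_right (by simp) (by simp)).1 this

/-! ### The supremum loss without corruption -/

theorem enorm_sq_le_lossSup {f g : ℝ → ℝ} {t : ℝ} (ht : t ∈ Icc (0 : ℝ) 1) :
    ‖f t - g t‖ₑ ^ 2 ≤ lossSup f g := by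
  unfold lossSup
  gcongr
  exact le_iSup₂_of_le (f := fun t _ => ‖f t - g t‖ₑ) t ht le_rfl

theorem ofReal_sq_le_enorm_sq {a r : ℝ} (hr : 0 ≤ r) (h : r ≤ |a|) :
    ENNReal.ofReal (r ^ 2) ≤ ‖a‖ₑ ^ 2 := by
  rw [ENNReal.ofReal_pow hr, Real.enorm_eq_ofReal_abs]
  gcongr

/-- Testing the zero function against a uniformly chosen single bump of height `A`. -/
theorem minimaxRisk_lossSup_ge_bumps {σ : ℝ} (hσ : 0 < σ) {m₁ L m₂ : ℝ≥0∞} {n m : ℕ} (hn : 0 < n)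
    (hm : 0 < m) {A : ℝ} (hA0 : 0 ≤ A)
    (hclass : ∀ S : Finset (Fin m), S.card ≤ 1 → cellSum kern A S ∈ sobolevClass m₁ L)
    (hA : Real.exp (A ^ 2 * (2 * n / m) / σ ^ 2) ≤ m / 2) (x : Fin n → ℝ) (q : ℕ) :
    ENNReal.ofReal (A ^ 2 / 16) ≤ minimaxRisk lossSup σ m₁ L m₂ x q := by
  classical
  refine le_minimaxRisk fun fhat hfhat R hR => ?_
  have hm' : (0 : ℝ) < m := by exact_mod_cast hm
  set v : ℝ≥0 := (σ ^ 2).toNNReal with hvdef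
  have hvc : (v : ℝ) = σ ^ 2 := Real.coe_toNNReal _ (sq_nonneg σ)
  have hv : v ≠ 0 := by
    rw [hvdef, Ne, Real.toNNReal_eq_zero, not_le]; positivity
  set γ := Measure.pi fun _ : Fin n => gaussianReal 0 v with hγ
  set G := sparseCells x m
  have hcard : (m : ℝ) ≤ 2 * G.card := by exact_mod_cast le_two_mul_card_sparseCells hn x m
  have hG : G.Nonempty := by
    rw [← Finset.card_pos]
    have : (0 : ℝ) < G.card := by linarith
    exact_mod_cast this
  set c : Fin m → ℝ := fun k => ((k : ℕ) + 1 / 2) / m with hc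
  have hcm : ∀ k, c k ∈ midCell k := fun k => by
    constructor <;> exact div_le_div_of_nonneg_right (by linarith) hm'.le
  have hfc : ∀ k, cellSum kern A {k} (c k) = A := fun k => by
    simp [cellSum, kern_eq_one (mul_sub_mem_of_mem_midCell (hcm k))]
  set D := ENNReal.ofReal ((A / 2) ^ 2)
  set E : Set (Fin n → ℝ) := ⋃ k ∈ G, {z | A / 2 ≤ |fhat z (c k)|} with hE
  have hEm : MeasurableSet E := by
    refine G.measurableSet_biUnion fun k _ => ?_
    have : Measurable fun z => fhat z (c k) := hfhat.comp measurable_prodMk_right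
    exact measurableSet_le measurable_const (by fun_prop)
  -- If the estimator is large at some centre it fails at `0`; otherwise it fails at every bump.
  have hzero : ∫⁻ ε, E.indicator (fun _ => D) ε ∂γ ≤ R := by
    refine le_trans ?_ (hR _ (hclass ∅ (by simp)) _ (gaussianReal_mem_noiseLaws hσ))
    refine le_trans (lintegral_mono fun ε => ?_) (lintegral_clean_le_risk _ _ _ _ _ _ _)
    by_cases hε : ε ∈ E
    · rw [indicator_of_mem hε]
      simp only [hE, mem_iUnion, mem_ofPred_eq] at hε
      obtain ⟨k, _, hk⟩ := hε
      refine le_trans ?_ (enorm_sq_le_lossSup (midCell_subset k (hcm k)))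
      refine ofReal_sq_le_enorm_sq (by positivity) ?_
      simpa [cellSum] using hk
    · simp [indicator_of_notMem hε]
  have hbump : ∀ k ∈ G, ∫⁻ ε, Eᶜ.indicator (fun _ => D)
      (fun i => cellSum kern A {k} (x i) + ε i) ∂γ ≤ R := by
    intro k hk
    refine le_trans ?_ (hR _ (hclass {k} (by simp)) _ (gaussianReal_mem_noiseLaws hσ))
    refine le_trans (lintegral_mono fun ε => ?_) (lintegral_clean_le_risk _ _ _ _ _ _ _)
    by_cases hε : (fun i => cellSum kern A {k} (x i) + ε i) ∈ Eᶜ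
    · rw [indicator_of_mem hε]
      simp only [hE, mem_compl_iff, mem_iUnion, mem_ofPred_eq, not_exists, not_le] at hε
      refine le_trans ?_ (enorm_sq_le_lossSup (midCell_subset k (hcm k)))
      refine ofReal_sq_le_enorm_sq (by positivity) ?_
      have h1 := abs_lt.1 (hε k hk)
      rw [hfc]
      exact (by linarith [h1.2] : A / 2 ≤ _).trans (le_abs_self _)
    · simp [indicator_of_notMem hε]
  -- Bumps on different cells are orthogonal, so only the diagonal of the double sum matters.
  have hcross : ∀ j ∈ G, ∀ k ∈ G,
      Real.exp ((∑ i, cellSum kern A {j} (x i) * cellSum kern A {k} (x i)) / v) ≤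
        1 + if j = k then (G.card : ℝ) else 0 := by
    intro j hj k _
    split_ifs with hjk
    · subst hjk
      refine le_trans (le_trans (Real.exp_le_exp.2 ?_) hA) (by linarith)
      rw [hvc]
      gcongr
      refine le_trans (le_of_eq ?_) (sum_sq_kern_le hm hj A)
      exact Finset.sum_congr rfl fun i _ => by simp [cellSum, sq]
    · rw [Finset.sum_eq_zero, zero_div, Real.exp_zero, add_zero]
      intro i _
      by_contra hne
      simp only [cellSum, Finset.sum_singleton] at hne
      have h1 := right_ne_zero_of_mul (left_ne_zero_of_mul hne)
      have h2 := right_ne_zero_of_mul (right_ne_zero_of_mul hne)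
      exact hjk (cell_unique (not_not.1 fun h => h1 (kern_eq_zero h))
        (not_not.1 fun h => h2 (kern_eq_zero h)))
  have htest := gaussian_mixture_test hv G hG (fun k i => cellSum kern A {k} (x i))
    (u := E.indicator fun _ => D) (w := Eᶜ.indicator fun _ => D) ?_
    (measurable_const.indicator hEm) (measurable_const.indicator hEm.compl) D ?_
  · have h1 : (G.card : ℝ≥0∞) * D ≤ G.card * (4 * R) :=
      calc (G.card : ℝ≥0∞) * D ≤ 2 * (G.card * R + ∑ _k ∈ G, R) := by
            refine htest.trans ?_
            gcongr with k hk
            exact hbump k hk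
        _ = G.card * (4 * R) := by rw [Finset.sum_const, nsmul_eq_mul]; ring
    have h2 := (ENNReal.mul_le_mul_iff_right (by simpa using hG.ne_empty) (by simp)).1 h1
    refine (ENNReal.mul_le_mul_iff_right (a := 4) (by simp) (by simp)).1 (le_trans ?_ h2)
    rw [← ENNReal.ofReal_ofNat 4, ← ENNReal.ofReal_mul (by norm_num)]
    exact ENNReal.ofReal_le_ofReal (by linarith)
  · calc _ ≤ ∑ j ∈ G, ∑ k ∈ G, (1 + if j = k then (G.card : ℝ) else 0) :=
          Finset.sum_le_sum fun j hj => Finset.sum_le_sum fun k hk => hcross j hj k hk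
      _ = ∑ j ∈ G, (2 * (G.card : ℝ)) := by
          refine Finset.sum_congr rfl fun j hj => ?_
          rw [Finset.sum_add_distrib, Finset.sum_ite_eq, if_pos hj]
          simp; ring
      _ = 2 * (G.card : ℝ) ^ 2 := by rw [Finset.sum_const, nsmul_eq_mul]; ring
  · intro z
    by_cases hz : z ∈ E <;> simp [hz]

/-! ### The erasing adversary -/

/-- The mixture `(1 - p) U[-1, 1] + p U(1, 2]`. -/
noncomputable def mixLaw (p : ℝ) : Measure ℝ :=
  ENNReal.ofReal ((1 - p) / 2) • volume.restrict (Icc (-1) 1) +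
    ENNReal.ofReal p • volume.restrict (Ioc 1 2)

theorem isProbabilityMeasure_mixLaw {p : ℝ} (h0 : 0 ≤ p) (h1 : p ≤ 1) :
    IsProbabilityMeasure (mixLaw p) := by
  constructor
  simp only [mixLaw, Measure.add_apply, Measure.smul_apply, Measure.restrict_apply_univ,
    Real.volume_Icc, Real.volume_Ioc, smul_eq_mul]
  rw [← ENNReal.ofReal_mul (by linarith), ← ENNReal.ofReal_mul h0,
    ← ENNReal.ofReal_add (by linarith) (by linarith), ← ENNReal.ofReal_one]
  congr 1
  ring

theorem mixLaw_absolutelyContinuous (p : ℝ) : mixLaw p ≪ volume :=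
  ((Measure.absolutelyContinuous_of_le Measure.restrict_le_self).smul_left _).add_left
    ((Measure.absolutelyContinuous_of_le Measure.restrict_le_self).smul_left _)

theorem integrable_mixLaw (p : ℝ) {f : ℝ → ℝ} (hf : Continuous f) : Integrable f (mixLaw p) := by
  refine Integrable.add_measure (Integrable.smul_measure ?_ (by simp))
    (Integrable.smul_measure ?_ (by simp))
  · exact hf.integrableOn_Icc
  · exact (hf.integrableOn_Icc (a := 1) (b := 2)).mono_set Ioc_subset_Icc_self

theorem integral_quadratic_mixLaw {p : ℝ} (h0 : 0 ≤ p) (h1 : p ≤ 1) (a b c : ℝ) :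
    ∫ w, (a * w ^ 2 + b * w + c) ∂(mixLaw p) = a * (1 / 3 + 2 * p) + b * (3 * p / 2) + c := by
  have hf : Continuous fun w : ℝ => a * w ^ 2 + b * w + c := by fun_prop
  have hI : ∀ l r : ℝ, ∫ w in l..r, (a * w ^ 2 + b * w + c)
      = a * ((r ^ 3 - l ^ 3) / 3) + b * ((r ^ 2 - l ^ 2) / 2) + c * (r - l) := by
    intro l r
    have hi : ∀ f : ℝ → ℝ, Continuous f → IntervalIntegrable f volume l r :=
      fun f hf => hf.intervalIntegrable l r
    rw [intervalIntegral.integral_add (hi _ (by fun_prop)) (hi _ (by fun_prop)),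
      intervalIntegral.integral_add (hi _ (by fun_prop)) (hi _ (by fun_prop)),
      intervalIntegral.integral_const_mul, intervalIntegral.integral_const_mul, integral_pow,
      integral_id, intervalIntegral.integral_const]
    norm_num
    ring
  unfold mixLaw
  rw [integral_add_measure ((hf.integrableOn_Icc).smul_measure (by simp))
      (((hf.integrableOn_Icc (a := 1) (b := 2)).mono_set Ioc_subset_Icc_self).smul_measure
        (by simp)),
    integral_smul_measure, integral_smul_measure, integral_Icc_eq_integral_Ioc,
    ← intervalIntegral.integral_of_le (by norm_num), ← intervalIntegral.integral_of_le (by norm_num),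
    hI, hI, ENNReal.toReal_ofReal (by linarith), ENNReal.toReal_ofReal h0, smul_eq_mul, smul_eq_mul]
  ring

/-- `mixLaw p` has mean `3 p / 2` and variance `1 / 3 + 2 p - 9 p² / 4`. -/
theorem map_affine_mixLaw_mem_noiseLaws {σ p c : ℝ} (h0 : 0 ≤ p) (h1 : p ≤ 1) (hc : c ≠ 0)
    (hcσ : c ^ 2 * (1 / 3 + 2 * p - 9 * p ^ 2 / 4) = σ ^ 2) :
    (mixLaw p).map (fun w => c * (w - 3 * p / 2)) ∈ noiseLaws σ := by
  have := isProbabilityMeasure_mixLaw h0 h1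
  have hm : Measurable fun w : ℝ => c * (w - 3 * p / 2) := by fun_prop
  have hmean : ∫ u, u ∂((mixLaw p).map fun w => c * (w - 3 * p / 2)) = 0 := by
    rw [integral_map hm.aemeasurable (by fun_prop)]
    have := integral_quadratic_mixLaw h0 h1 0 c (-(c * (3 * p / 2)))
    rw [show (fun w : ℝ => c * (w - 3 * p / 2))
      = fun w => 0 * w ^ 2 + c * w + -(c * (3 * p / 2)) by ext w; ring, this]
    ring
  refine ⟨Measure.isProbabilityMeasure_map hm.aemeasurable, ?_, ?_, hmean, ?_⟩
  · refine ((mixLaw_absolutelyContinuous p).map hm).trans ?_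
    have h2 : Measure.map (fun w : ℝ => c * (w - 3 * p / 2)) volume
        = ENNReal.ofReal |c⁻¹| • volume := by
      rw [← Real.map_volume_mul_left hc]
      nth_rw 2 [← (measurePreserving_sub_right volume (3 * p / 2)).map_eq]
      rw [Measure.map_map (by fun_prop) (by fun_prop)]
      rfl
    rw [h2]
    exact Measure.smul_absolutelyContinuous
  · rw [memLp_map_measure_iff (by fun_prop) hm.aemeasurable, memLp_two_iff_integrable_sq (by fun_prop)]
    exact integrable_mixLaw p (by simp only [Function.comp_def, id]; fun_prop)
  · rw [variance_of_integral_eq_zero (by fun_prop) (by simpa using hmean),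
      integral_map hm.aemeasurable (by fun_prop)]
    have := integral_quadratic_mixLaw h0 h1 (c ^ 2) (-(c ^ 2 * (3 * p))) (c ^ 2 * (9 * p ^ 2 / 4))
    simp only [id]
    rw [show (fun w : ℝ => (c * (w - 3 * p / 2)) ^ 2) = fun w => c ^ 2 * w ^ 2
      + -(c ^ 2 * (3 * p)) * w + c ^ 2 * (9 * p ^ 2 / 4) by ext w; ring, this, ← hcσ]
    ring

/-- Erase values of modulus larger than `s`. -/
noncomputable def erase (s y : ℝ) : ℝ := if |y| ≤ s then y else 0

theorem measurable_erase (s : ℝ) : Measurable (erase s) :=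
  Measurable.ite (measurableSet_le (by fun_prop) measurable_const) measurable_id measurable_const

/-- The law of one response after erasure. -/
noncomputable def erasedLaw (s p : ℝ) : Measure ℝ := (mixLaw p).map fun w => erase s (s * w)

theorem measurable_erase_mul (s c : ℝ) : Measurable fun w => erase s (c * w) :=
  (measurable_erase s).comp (by fun_prop)

/-- After erasure, the responses `s w` and `-s w` have the same law: erasure removes the
asymmetric part of `mixLaw`. -/
theorem map_erase_neg {s : ℝ} (hs : 0 < s) (p : ℝ) :
    (mixLaw p).map (fun w => erase s (-s * w)) = erasedLaw s p := by
  refine Measure.ext_of_lintegral _ fun h hh => ?_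
  rw [erasedLaw, lintegral_map hh (measurable_erase_mul _ _),
    lintegral_map hh (measurable_erase_mul _ _)]
  simp only [mixLaw, lintegral_add_measure, lintegral_smul_measure]
  congr 2
  · have hmp := (Measure.measurePreserving_neg (volume : Measure ℝ)).setLIntegral_comp_preimage
      (s := Icc (-1 : ℝ) 1) measurableSet_Icc
      (f := fun w => h (erase s (s * w))) (hh.comp (measurable_erase_mul _ _))
    simpa using hmp
  · refine setLIntegral_congr_fun measurableSet_Ioc fun w hw => ?_
    have h1 : s < s * w := by nlinarith [hw.1]
    have e1 : erase s (s * w) = 0 := if_neg (by rw [abs_of_pos (hs.trans h1)]; exact not_le.2 h1)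
    have e2 : erase s (-s * w) = 0 :=
      if_neg (by rw [neg_mul, abs_neg, abs_of_pos (hs.trans h1)]; exact not_le.2 h1)
    simp only [e1, e2]

theorem erasedLaw_singleton_le {s p : ℝ} (hs : 0 < s) :
    erasedLaw s p {0} ≤ ENNReal.ofReal p := by
  rw [erasedLaw, Measure.map_apply (measurable_erase_mul _ _) (measurableSet_singleton 0)]
  have hms : MeasurableSet ((fun w => erase s (s * w)) ⁻¹' {0}) :=
    measurable_erase_mul _ _ (measurableSet_singleton 0)
  simp only [mixLaw, Measure.add_apply, Measure.smul_apply, smul_eq_mul,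
    Measure.restrict_apply hms]
  have h1 : volume ((fun w => erase s (s * w)) ⁻¹' {0} ∩ Icc (-1) 1) = 0 := by
    refine measure_mono_null (t := {0}) ?_ (by simp)
    rintro w ⟨hw, hw'⟩
    have : |s * w| ≤ s := by
      rw [abs_mul, abs_of_pos hs]
      exact mul_le_of_le_one_right hs.le (abs_le.2 hw')
    have hw0 : erase s (s * w) = 0 := hw
    rw [erase, if_pos this] at hw0
    exact (mul_eq_zero.1 hw0).resolve_left hs.ne'
  rw [h1, mul_zero, zero_add]
  calc _ ≤ ENNReal.ofReal p * volume (Ioc (1 : ℝ) 2) := by gcongr; exact inter_subset_right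
    _ = ENNReal.ofReal p := by rw [Real.volume_Ioc]; norm_num

/-- The data vectors with at most `q` vanishing entries. -/
def fewZeros (n q : ℕ) : Set (Fin n → ℝ) :=
  {z | ∑ i, ({0} : Set ℝ).indicator (fun _ => (1 : ℝ≥0∞)) (z i) ≤ q}

theorem measurable_sum_indicator_zero (n : ℕ) :
    Measurable fun z : Fin n → ℝ => ∑ i, ({0} : Set ℝ).indicator (fun _ => (1 : ℝ≥0∞)) (z i) :=
  Finset.measurable_sum _ fun i _ =>
    (measurable_const.indicator (measurableSet_singleton 0)).comp (measurable_pi_apply i)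

theorem measurableSet_fewZeros (n q : ℕ) : MeasurableSet (fewZeros n q) :=
  measurableSet_le (measurable_sum_indicator_zero n) measurable_const

/-- Markov's inequality for the number of vanishing entries. -/
theorem one_le_two_mul_fewZeros {n q : ℕ} (ν : Measure ℝ) [IsProbabilityMeasure ν] {p : ℝ}
    (hν : ν {0} ≤ ENNReal.ofReal p) (hnp : 2 * n * p ≤ q) :
    1 ≤ 2 * Measure.pi (fun _ : Fin n => ν) (fewZeros n q) := by
  set P := Measure.pi fun _ : Fin n => ν
  set N : (Fin n → ℝ) → ℝ≥0∞ := fun z => ∑ i, ({0} : Set ℝ).indicator (fun _ => 1) (z i) with hN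
  have hNm : Measurable N := measurable_sum_indicator_zero n
  have hNint : 2 * ∫⁻ z, N z ∂P ≤ q := by
    have : ∫⁻ z, N z ∂P = n * ν {0} := by
      have hind : ∀ i : Fin n, Measurable fun z : Fin n → ℝ =>
          ({0} : Set ℝ).indicator (fun _ => (1 : ℝ≥0∞)) (z i) := fun i =>
        (measurable_const.indicator (measurableSet_singleton 0)).comp (measurable_pi_apply i)
      simp only [hN]
      rw [lintegral_finsetSum _ fun i _ => hind i]
      have : ∀ i : Fin n, ∫⁻ z, ({0} : Set ℝ).indicator (fun _ => (1 : ℝ≥0∞)) (z i) ∂P = ν {0} := by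
        intro i
        rw [(measurePreserving_eval (fun _ : Fin n => ν) i).lintegral_comp
          (f := ({0} : Set ℝ).indicator fun _ => (1 : ℝ≥0∞))
          (measurable_const.indicator (measurableSet_singleton 0)),
          lintegral_indicator_const (measurableSet_singleton 0), one_mul]
      rw [Finset.sum_congr rfl fun i _ => this i]
      simp
    rw [this]
    calc 2 * ((n : ℝ≥0∞) * ν {0}) ≤ 2 * (n * ENNReal.ofReal p) := by gcongr
      _ = ENNReal.ofReal (2 * n * p) := by
        rw [ENNReal.ofReal_mul (by positivity), ENNReal.ofReal_mul (by positivity)]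
        simp [mul_assoc]
      _ ≤ q := by
        rw [← ENNReal.ofReal_natCast]
        exact ENNReal.ofReal_le_ofReal hnp
  have hc : 2 * P (fewZeros n q)ᶜ ≤ 1 := by
    -- For `q = 0` Markov's inequality is void, but then the expected number of zeros vanishes.
    by_cases hq : q = 0
    · have h0 : ∫⁻ z, N z ∂P = 0 := by simpa [hq] using hNint
      rw [lintegral_eq_zero_iff hNm] at h0
      have : P (fewZeros n q)ᶜ = 0 := by
        rw [← mem_ae_iff]
        filter_upwards [h0] with z hz
        have hz' : N z = 0 := hz
        change N z ≤ q
        rw [hz']; exact zero_le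
      simp [this]
    · have h1 := mul_meas_ge_le_lintegral (μ := P) hNm q
      have h2 : P (fewZeros n q)ᶜ ≤ P {z | (q : ℝ≥0∞) ≤ N z} :=
        measure_mono fun z hz => (not_le.1 (show ¬ N z ≤ q from hz)).le
      have h3 : (q : ℝ≥0∞) * (2 * P (fewZeros n q)ᶜ) ≤ q * 1 :=
        calc (q : ℝ≥0∞) * (2 * P (fewZeros n q)ᶜ)
            = 2 * (q * P (fewZeros n q)ᶜ) := by ring
          _ ≤ 2 * (q * P {z | (q : ℝ≥0∞) ≤ N z}) := by gcongr
          _ ≤ 2 * ∫⁻ z, N z ∂P := by gcongr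
          _ ≤ q * 1 := by rwa [mul_one]
      exact (ENNReal.mul_le_mul_iff_right (by exact_mod_cast hq) (by simp)).1 h3
  have htot : P (fewZeros n q) + P (fewZeros n q)ᶜ = 1 :=
    prob_add_prob_compl (measurableSet_fewZeros n q)
  refine (ENNReal.add_le_add_iff_right (a := 1) (by simp)).1 ?_
  calc (1 : ℝ≥0∞) + 1 = 2 * (P (fewZeros n q) + P (fewZeros n q)ᶜ) := by
        rw [htot, mul_one, one_add_one_eq_two]
    _ = 2 * P (fewZeros n q) + 2 * P (fewZeros n q)ᶜ := mul_add _ _ _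
    _ ≤ 2 * P (fewZeros n q) + 1 := by gcongr

theorem const_mem_sobolevClass {m₁ L : ℝ≥0∞} {a : ℝ} (h : ENNReal.ofReal |a| ≤ m₁) :
    (fun _ => a) ∈ sobolevClass m₁ L :=
  ⟨fun _ => 0, fun _ => 0, isSobolevTwo_of_hasDerivAt (fun t => hasDerivAt_const t a)
    (fun t => hasDerivAt_const t 0) continuous_const,
    fun t _ => by rwa [Real.enorm_eq_ofReal_abs], by simp⟩

/-- The erasing adversary, when at most `q` entries have to be erased. -/
theorem erase_mem_corruptedData {n q : ℕ} (x : Fin n → ℝ) (m₂ : ℝ≥0∞) (f : ℝ → ℝ) (ε : Fin n → ℝ)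
    (s : ℝ) (h : (fun i => erase s (f (x i) + ε i)) ∈ fewZeros n q) :
    (fun i => erase s (f (x i) + ε i)) ∈ corruptedData x q m₂ f ε := by
  classical
  refine ⟨Finset.univ.filter fun i => ¬ |f (x i) + ε i| ≤ s, ?_, ?_, ?_⟩
  · rw [← Nat.cast_le (α := ℝ≥0∞)]
    refine le_trans ?_ h
    rw [Finset.card_filter]
    push_cast
    refine Finset.sum_le_sum fun i _ => ?_
    by_cases hi : |f (x i) + ε i| ≤ s <;> simp [erase, hi]
  · intro i hi
    simp only [Finset.mem_filter_univ, not_not] at hi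
    exact if_pos hi
  · intro i hi
    simp only [Finset.mem_filter_univ] at hi
    simp [erase, hi]

/-- Risk at the constant `c (3 p / 2)` under noise `c (w - 3 p / 2)`, for which the clean responses
are `c w`: on the event that at most `q` entries vanish after erasure, the adversary can present the
erased data. -/
theorem lintegral_erased_le_risk {loss : (ℝ → ℝ) → (ℝ → ℝ) → ℝ≥0∞} {n : ℕ} (x : Fin n → ℝ) (q : ℕ)
    (m₂ : ℝ≥0∞) {s p c : ℝ} (hp0 : 0 ≤ p) (hp1 : p ≤ 1)
    (hc : (mixLaw p).map (fun w => erase s (c * w)) = erasedLaw s p)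
    {fhat : (Fin n → ℝ) → ℝ → ℝ} {ℓ : (Fin n → ℝ) → ℝ≥0∞} (hℓm : Measurable ℓ)
    (hℓ : ∀ z, ℓ z ≤ loss (fun _ => c * (3 * p / 2)) (fhat z)) :
    ∫⁻ z in fewZeros n q, ℓ z ∂(Measure.pi fun _ : Fin n => erasedLaw s p) ≤
      risk loss x q m₂ ((mixLaw p).map fun w => c * (w - 3 * p / 2))
        (fun _ => c * (3 * p / 2)) fhat := by
  have := isProbabilityMeasure_mixLaw hp0 hp1
  have hm : Measurable fun w : ℝ => c * (w - 3 * p / 2) := by fun_prop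
  have hem : Measurable fun u : ℝ => erase s (c * (3 * p / 2) + u) :=
    (measurable_erase s).comp (by fun_prop)
  have : IsProbabilityMeasure ((mixLaw p).map fun w => c * (w - 3 * p / 2)) :=
    Measure.isProbabilityMeasure_map hm.aemeasurable
  have : IsProbabilityMeasure (erasedLaw s p) :=
    Measure.isProbabilityMeasure_map (measurable_erase_mul _ _).aemeasurable
  have hmp : MeasurePreserving (fun u : ℝ => erase s (c * (3 * p / 2) + u))
      ((mixLaw p).map fun w => c * (w - 3 * p / 2)) (erasedLaw s p) := by
    refine ⟨hem, ?_⟩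
    rw [Measure.map_map hem hm, ← hc]
    congr 1
    ext w
    simp only [Function.comp]
    congr 1
    ring
  have hpi := measurePreserving_pi
    (fun _ : Fin n => (mixLaw p).map fun w => c * (w - 3 * p / 2)) (fun _ => erasedLaw s p)
    fun _ => hmp
  rw [← lintegral_indicator (measurableSet_fewZeros n q),
    ← hpi.lintegral_comp (hℓm.indicator (measurableSet_fewZeros n q))]
  refine lintegral_mono fun ε => ?_
  by_cases h : (fun i => erase s (c * (3 * p / 2) + ε i)) ∈ fewZeros n q
  · rw [indicator_of_mem h]
    exact le_iSup₂_of_le (f := fun y _ => loss (fun _ => c * (3 * p / 2)) (fhat y)) _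
      (erase_mem_corruptedData x m₂ (fun _ => c * (3 * p / 2)) ε s h) (hℓ _)
  · rw [indicator_of_notMem h]
    exact zero_le

/-- The erasing adversary makes the constants `± s (3 p / 2)` indistinguishable. Here `ℓ` is a
measurable minorant of the loss at constant functions that separates any two constants. -/
theorem minimaxRisk_ge_erasure {loss : (ℝ → ℝ) → (ℝ → ℝ) → ℝ≥0∞} (ℓ : ℝ → (ℝ → ℝ) → ℝ≥0∞)
    (hℓ : ∀ a g, ℓ a g ≤ loss (fun _ => a) g)
    (hsep : ∀ a b g, Measurable g → ENNReal.ofReal ((a - b) ^ 2 / 2) ≤ ℓ a g + ℓ b g)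
    {n : ℕ} (hmeas : ∀ a, ∀ fhat : (Fin n → ℝ) → ℝ → ℝ,
      (Measurable fun p : (Fin n → ℝ) × ℝ => fhat p.1 p.2) → Measurable fun z => ℓ a (fhat z))
    {σ : ℝ} (hσ : 0 < σ) {m₁ L m₂ : ℝ≥0∞} {p : ℝ} (hp0 : 0 ≤ p) (hp1 : p ≤ 1 / 2)
    (hm₁ : ENNReal.ofReal (3 * σ * p) ≤ m₁) {q : ℕ} (hnp : 2 * n * p ≤ q) (x : Fin n → ℝ) :
    ENNReal.ofReal ((σ * p) ^ 2 / 2) ≤ minimaxRisk loss σ m₁ L m₂ x q := by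
  refine le_minimaxRisk fun fhat hfhat R hR => ?_
  have hp1' : p ≤ 1 := hp1.trans (by norm_num)
  have := isProbabilityMeasure_mixLaw hp0 hp1'
  -- The scale `s` is chosen such that the noise has variance `σ²`; it is comparable to `σ`.
  set V := 1 / 3 + 2 * p - 9 * p ^ 2 / 4 with hV
  have hV1 : (1 / 2) ^ 2 ≤ V := by nlinarith
  have hV2 : V ≤ (3 / 2) ^ 2 := by nlinarith
  have hVpos : 0 < V := lt_of_lt_of_le (by norm_num) hV1
  have hr1 : 1 / 2 ≤ √V := Real.le_sqrt_of_sq_le hV1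
  have hr2 : √V ≤ 3 / 2 := Real.sqrt_le_iff.2 ⟨by norm_num, hV2⟩
  have hrpos : 0 < √V := by linarith
  set s := σ / √V with hs
  have hspos : 0 < s := by positivity
  have hsV : s ^ 2 * V = σ ^ 2 := by
    rw [hs, div_pow, Real.sq_sqrt hVpos.le]; field_simp
  have hslo : 2 / 3 * σ ≤ s := by
    rw [hs, le_div_iff₀ hrpos]; nlinarith
  have hshi : s ≤ 2 * σ := by
    rw [hs, div_le_iff₀ hrpos]; nlinarith
  set ν := erasedLaw s p
  have : IsProbabilityMeasure ν :=
    Measure.isProbabilityMeasure_map (measurable_erase_mul _ _).aemeasurable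
  have hrisk : ∀ c : ℝ, |c| = s → (mixLaw p).map (fun w => erase s (c * w)) = erasedLaw s p →
      ∫⁻ z in fewZeros n q, ℓ (c * (3 * p / 2)) (fhat z) ∂(Measure.pi fun _ : Fin n => ν) ≤ R := by
    intro c hcs hc
    refine (lintegral_erased_le_risk x q m₂ hp0 hp1' hc (hmeas _ fhat hfhat)
      fun z => hℓ _ _).trans (hR _ (const_mem_sobolevClass ?_) _
        (map_affine_mixLaw_mem_noiseLaws hp0 hp1' ?_ ?_))
    · refine le_trans (ENNReal.ofReal_le_ofReal ?_) hm₁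
      rw [abs_mul, hcs, abs_of_nonneg (by positivity)]
      nlinarith
    · rw [← abs_pos, hcs]; exact hspos
    · rw [← sq_abs, hcs]; exact hsV
  have hplus := hrisk s (abs_of_pos hspos) rfl
  have hminus := hrisk (-s) (by rw [abs_neg, abs_of_pos hspos]) (map_erase_neg hspos p)
  set D := ENNReal.ofReal ((s * (3 * p / 2) - -s * (3 * p / 2)) ^ 2 / 2) with hD
  have hfew := one_le_two_mul_fewZeros (n := n) (q := q) ν (erasedLaw_singleton_le hspos) hnp
  have hD4 : D ≤ 4 * R := by
    calc D = D * 1 := (mul_one _).symm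
      _ ≤ D * (2 * Measure.pi (fun _ : Fin n => ν) (fewZeros n q)) := by gcongr
      _ = 2 * ∫⁻ z in fewZeros n q, D ∂(Measure.pi fun _ : Fin n => ν) := by
        rw [setLIntegral_const]; ring
      _ ≤ 2 * ∫⁻ z in fewZeros n q, (ℓ (s * (3 * p / 2)) (fhat z) + ℓ (-s * (3 * p / 2)) (fhat z))
            ∂(Measure.pi fun _ : Fin n => ν) := by
        gcongr with z
        exact hsep _ _ _ (hfhat.comp measurable_prodMk_left)
      _ ≤ 2 * (R + R) := by
        rw [lintegral_add_left (hmeas _ fhat hfhat)]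
        gcongr
      _ = 4 * R := by ring
  refine (ENNReal.mul_le_mul_iff_right (a := 4) (by simp) (by simp)).1 (le_trans ?_ hD4)
  rw [← ENNReal.ofReal_ofNat 4, ← ENNReal.ofReal_mul (by norm_num), hD]
  refine ENNReal.ofReal_le_ofReal ?_
  have h1 : (2 / 3 * σ) ^ 2 ≤ s ^ 2 := by gcongr
  nlinarith [mul_le_mul_of_nonneg_right h1 (sq_nonneg p)]

theorem minimaxRisk_lossTwo_ge_erasure {σ : ℝ} (hσ : 0 < σ) {m₁ L m₂ : ℝ≥0∞} {p : ℝ} (hp0 : 0 ≤ p)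
    (hp1 : p ≤ 1 / 2) (hm₁ : ENNReal.ofReal (3 * σ * p) ≤ m₁) {n q : ℕ} (hnp : 2 * n * p ≤ q)
    (x : Fin n → ℝ) :
    ENNReal.ofReal ((σ * p) ^ 2 / 2) ≤ minimaxRisk lossTwo σ m₁ L m₂ x q := by
  refine minimaxRisk_ge_erasure (fun a g => lossTwo (fun _ => a) g) (fun _ _ => le_rfl) ?_ ?_
    hσ hp0 hp1 hm₁ hnp x
  · intro a b g hg
    unfold lossTwo
    rw [← lintegral_add_left (by fun_prop)]
    calc ENNReal.ofReal ((a - b) ^ 2 / 2)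
        = ∫⁻ t in Icc (0 : ℝ) 1, ENNReal.ofReal ((a - b) ^ 2 / 2) := by simp
      _ ≤ _ := lintegral_mono fun t => half_sq_le_enorm_sq_add (abs_sub_comm b a)
  · intro a fhat hfhat
    unfold lossTwo
    refine Measurable.lintegral_prod_right'
      (f := fun p : (Fin n → ℝ) × ℝ => ‖a - fhat p.1 p.2‖ₑ ^ 2) (by fun_prop)

theorem minimaxRisk_lossSup_ge_erasure {σ : ℝ} (hσ : 0 < σ) {m₁ L m₂ : ℝ≥0∞} {p : ℝ} (hp0 : 0 ≤ p)
    (hp1 : p ≤ 1 / 2) (hm₁ : ENNReal.ofReal (3 * σ * p) ≤ m₁) {n q : ℕ} (hnp : 2 * n * p ≤ q)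
    (x : Fin n → ℝ) :
    ENNReal.ofReal ((σ * p) ^ 2 / 2) ≤ minimaxRisk lossSup σ m₁ L m₂ x q := by
  refine minimaxRisk_ge_erasure (fun a g => ‖a - g 0‖ₑ ^ 2) (fun a g => ?_) ?_ ?_
    hσ hp0 hp1 hm₁ hnp x
  · exact enorm_sq_le_lossSup (f := fun _ => a) (t := 0) (by simp)
  · intro a b g _
    exact half_sq_le_enorm_sq_add (abs_sub_comm b a)
  · intro a fhat hfhat
    have : Measurable fun z => fhat z 0 := hfhat.comp measurable_prodMk_right
    fun_prop

/-! ### Choice of the parameters and rates -/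

theorem exists_pos_ofReal_le {M : ℝ≥0∞} (hM : 0 < M) : ∃ r : ℝ, 0 < r ∧ ENNReal.ofReal r ≤ M := by
  obtain ⟨r, _, h1, h2⟩ := ENNReal.lt_iff_exists_real_btwn.1 hM
  exact ⟨r, ENNReal.ofReal_pos.1 h1, h2.le⟩

/-- The amplitude `a` of the bumps, before scaling: small against the bound `m₁`, the curvature
bound `L` and the noise level `σ`. -/
theorem exists_amplitude {σ : ℝ} (hσ : 0 < σ) {m₁ L : ℝ≥0∞} (hm₁ : 0 < m₁) (hL : 0 < L) :
    ∃ a C : ℝ, 0 < a ∧ 0 < C ∧ (∀ t, |deriv (deriv kern) t| ≤ C) ∧ ENNReal.ofReal a ≤ m₁ ∧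
      ENNReal.ofReal ((a * C) ^ 2) ≤ L ∧ 2 * a ^ 2 / σ ^ 2 ≤ 1 / 16 := by
  obtain ⟨C, hC, hK⟩ := exists_deriv2_kern_bound
  obtain ⟨r, hr, hrm⟩ := exists_pos_ofReal_le hm₁
  obtain ⟨l, hl, hlL⟩ := exists_pos_ofReal_le hL
  have ha : 0 < min r (min (√l / C) (σ / 6)) := by positivity
  refine ⟨min r (min (√l / C) (σ / 6)), C, ha, hC, hK, ?_, ?_, ?_⟩
  · exact (ENNReal.ofReal_le_ofReal (min_le_left _ _)).trans hrm
  · refine (ENNReal.ofReal_le_ofReal ?_).trans hlL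
    have h1 : min r (min (√l / C) (σ / 6)) * C ≤ √l := by
      rw [← le_div_iff₀ hC]
      exact (min_le_right _ _).trans (min_le_left _ _)
    calc _ ≤ √l ^ 2 := by gcongr
      _ = l := Real.sq_sqrt hl.le
  · have h1 : min r (min (√l / C) (σ / 6)) ≤ σ / 6 := (min_le_right _ _).trans (min_le_right _ _)
    rw [div_le_iff₀ (by positivity)]
    nlinarith

/-- The `n^(-4/5)` bound, from `m = ⌈n^(1/5)⌉` bumps of height `a / m²`. -/
theorem minimaxRisk_lossTwo_ge_nonparametric {σ : ℝ} (hσ : 0 < σ) {m₁ L : ℝ≥0∞} (hm₁ : 0 < m₁)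
    (hL : 0 < L) :
    ∃ c : ℝ, 0 < c ∧ ∀ᶠ n : ℕ in atTop, ∀ (x : Fin n → ℝ) (q : ℕ) (m₂ : ℝ≥0∞),
      ENNReal.ofReal (c * (n : ℝ) ^ (-(4 / 5) : ℝ)) ≤ minimaxRisk lossTwo σ m₁ L m₂ x q := by
  obtain ⟨a, C, ha, hC, hK, ham, haL, haσ⟩ := exists_amplitude hσ hm₁ hL
  refine ⟨a ^ 2 / 512, by positivity, ?_⟩
  filter_upwards [eventually_ge_atTop 1] with n hn x q m₂
  have hn1 : (1 : ℝ) ≤ n := by exact_mod_cast hn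
  set r : ℝ := (n : ℝ) ^ (1 / 5 : ℝ) with hr
  have hr1 : 1 ≤ r := Real.one_le_rpow hn1 (by norm_num)
  set m : ℕ := ⌈r⌉₊ with hm
  have hrm : r ≤ m := Nat.le_ceil r
  have hm2 : (m : ℝ) ≤ 2 * r := by
    have := (Nat.ceil_lt_add_one (by linarith : 0 ≤ r)).le
    linarith
  have hmpos : (0 : ℝ) < m := by linarith
  have hm1 : (1 : ℝ) ≤ m := hr1.trans hrm
  have hr5 : r ^ 5 = n := by
    rw [hr, ← Real.rpow_natCast, ← Real.rpow_mul (by linarith)]; norm_num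
  have hr4 : (n : ℝ) ^ (-(4 / 5) : ℝ) = (r ^ 4)⁻¹ := by
    rw [hr, ← Real.rpow_natCast, ← Real.rpow_mul (by linarith), ← Real.rpow_neg (by linarith)]
    norm_num
  have hnm : (n : ℝ) ≤ m ^ 5 := by rw [← hr5]; gcongr
  refine le_trans (ENNReal.ofReal_le_ofReal ?_) (minimaxRisk_lossTwo_ge_bumps hσ hn
    (by exact_mod_cast hmpos) (A := a / m ^ 2) (fun S => ?_) ?_ x q)
  · rw [hr4, ← div_eq_mul_inv, div_pow, div_div, div_div,
      div_le_div_iff₀ (by positivity) (by positivity)]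
    have : (m : ℝ) ^ 4 ≤ (2 * r) ^ 4 := by gcongr
    nlinarith [mul_le_mul_of_nonneg_left this (sq_nonneg a)]
  · refine cellSum_kern_mem_sobolevClass hC hK (by positivity) (by exact_mod_cast hmpos) S ?_ ?_
    · refine (ENNReal.ofReal_le_ofReal ?_).trans ham
      exact div_le_self ha.le (one_le_pow₀ hm1)
    · refine (ENNReal.ofReal_le_ofReal ?_).trans haL
      rw [div_mul_cancel₀ _ (by positivity), mul_div_assoc]
      refine mul_le_of_le_one_right (sq_nonneg _) ?_
      rw [div_le_one hmpos]
      exact_mod_cast (Finset.card_le_univ S).trans (Fintype.card_fin m).le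
  · have h1 : (a / m ^ 2) ^ 2 * (2 * n / m) / σ ^ 2 = 2 * a ^ 2 / σ ^ 2 * (n / m ^ 5) := by
      field_simp
    have h2 : (n : ℝ) / m ^ 5 ≤ 1 := (div_le_one (by positivity)).2 hnm
    have h3 : (a / m ^ 2) ^ 2 * (2 * n / m) / σ ^ 2 ≤ Real.log 2 := by
      rw [h1]
      refine (mul_le_of_le_one_right (by positivity) h2).trans (haσ.trans ?_)
      linarith [Real.log_two_gt_d9]
    calc _ ≤ Real.exp (Real.log 2) := Real.exp_le_exp.2 h3
      _ = 2 := Real.exp_log (by norm_num)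

/-- The `(log n / n)^(3/4)` bound, from `m = ⌈(n / log n)^(1/4)⌉` cells and a bump of height
`a m^(-3/2)`: on a sparse cell its energy is a small multiple of `log n`, so that hiding it among
the at least `m / 2` sparse cells makes it undetectable. -/
theorem minimaxRisk_lossSup_ge_nonparametric {σ : ℝ} (hσ : 0 < σ) {m₁ L : ℝ≥0∞} (hm₁ : 0 < m₁)
    (hL : 0 < L) :
    ∃ c : ℝ, 0 < c ∧ ∀ᶠ n : ℕ in atTop, ∀ (x : Fin n → ℝ) (q : ℕ) (m₂ : ℝ≥0∞),
      ENNReal.ofReal (c * (Real.log n / n) ^ (3 / 4 : ℝ)) ≤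
        minimaxRisk lossSup σ m₁ L m₂ x q := by
  obtain ⟨a, C, ha, hC, hK, ham, haL, haσ⟩ := exists_amplitude hσ hm₁ hL
  refine ⟨a ^ 2 / 128, by positivity, ?_⟩
  have hlog : ∀ᶠ n : ℕ in atTop, Real.log n ≤ (n : ℝ) ^ (1 / 2 : ℝ) := by
    have := (isLittleO_log_rpow_atTop (r := 1 / 2) (by norm_num)).bound one_pos
    filter_upwards [tendsto_natCast_atTop_atTop.eventually this] with n hn
    rw [one_mul, Real.norm_of_nonneg (by positivity : (0 : ℝ) ≤ (n : ℝ) ^ (1 / 2 : ℝ))] at hn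
    exact (le_abs_self _).trans hn
  have htwo : ∀ᶠ n : ℕ in atTop, 2 ≤ (n : ℝ) ^ (1 / 16 : ℝ) :=
    ((tendsto_rpow_atTop (by norm_num)).comp tendsto_natCast_atTop_atTop).eventually_ge_atTop 2
  filter_upwards [eventually_ge_atTop 2, hlog, htwo] with n hn hlogn htwon x q m₂
  have hn1 : (1 : ℝ) < n := by exact_mod_cast hn
  have hn0 : (0 : ℝ) < n := by linarith
  have hl0 : 0 < Real.log n := Real.log_pos hn1
  set r : ℝ := (n / Real.log n) ^ (1 / 4 : ℝ) with hr
  have hbase : (n : ℝ) ^ (1 / 2 : ℝ) ≤ n / Real.log n := by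
    rw [le_div_iff₀ hl0]
    calc (n : ℝ) ^ (1 / 2 : ℝ) * Real.log n ≤ (n : ℝ) ^ (1 / 2 : ℝ) * (n : ℝ) ^ (1 / 2 : ℝ) := by
          gcongr
      _ = n := by rw [← Real.rpow_add hn0]; norm_num
  have hr8 : (n : ℝ) ^ (1 / 8 : ℝ) ≤ r := by
    calc (n : ℝ) ^ (1 / 8 : ℝ) = ((n : ℝ) ^ (1 / 2 : ℝ)) ^ (1 / 4 : ℝ) := by
          rw [← Real.rpow_mul hn0.le]; norm_num
      _ ≤ r := by rw [hr]; gcongr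
  have hr1 : 1 ≤ r := (Real.one_le_rpow hn1.le (by norm_num)).trans hr8
  set m : ℕ := ⌈r⌉₊ with hm
  have hrm : r ≤ m := Nat.le_ceil r
  have hm2 : (m : ℝ) ≤ 2 * r := by
    have := (Nat.ceil_lt_add_one (by linarith : 0 ≤ r)).le
    linarith
  have hmpos : (0 : ℝ) < m := by linarith
  have hm1 : (1 : ℝ) ≤ m := hr1.trans hrm
  have hq0 : 0 < n / Real.log n := by positivity
  have hr4 : r ^ 4 = n / Real.log n := by
    rw [hr, ← Real.rpow_natCast, ← Real.rpow_mul hq0.le]; norm_num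
  have hr3 : (Real.log n / n) ^ (3 / 4 : ℝ) = (r ^ 3)⁻¹ := by
    rw [hr, ← Real.rpow_natCast, ← Real.rpow_mul hq0.le, ← Real.inv_rpow hq0.le, inv_div]
    norm_num
  have hnm : (n : ℝ) / m ^ 4 ≤ Real.log n := by
    have : n / Real.log n ≤ (m : ℝ) ^ 4 := by rw [← hr4]; gcongr
    rw [div_le_iff₀ hl0] at this
    rw [div_le_iff₀ (by positivity)]
    linarith
  have hs2 : (√(m : ℝ)) ^ 2 = m := Real.sq_sqrt hmpos.le
  have hs1 : 1 ≤ √(m : ℝ) := Real.one_le_sqrt.2 hm1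
  -- The height `a m ^ (-3/2)` is the largest for which a single bump has bounded curvature.
  have hA2 : (a / (m * √m)) ^ 2 = a ^ 2 / m ^ 3 := by
    rw [div_pow, mul_pow, hs2]; ring
  refine le_trans (ENNReal.ofReal_le_ofReal ?_) (minimaxRisk_lossSup_ge_bumps hσ (by omega)
    (by exact_mod_cast hmpos) (A := a / (m * √m)) (by positivity) (fun S hS => ?_) ?_ x q)
  · rw [hr3, ← div_eq_mul_inv, hA2, div_div, div_div,
      div_le_div_iff₀ (by positivity) (by positivity)]
    have : (m : ℝ) ^ 3 ≤ (2 * r) ^ 3 := by gcongr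
    nlinarith [mul_le_mul_of_nonneg_left this (sq_nonneg a)]
  · refine cellSum_kern_mem_sobolevClass hC hK (by positivity) (by exact_mod_cast hmpos) S ?_ ?_
    · refine (ENNReal.ofReal_le_ofReal ?_).trans ham
      exact div_le_self ha.le (one_le_mul_of_one_le_of_one_le hm1 hs1)
    · refine (ENNReal.ofReal_le_ofReal ?_).trans haL
      have h1 : (a / (m * √m) * m ^ 2 * C) ^ 2 * S.card / m = (a * C) ^ 2 * S.card := by
        rw [mul_pow, mul_pow, hA2]; field_simp
      rw [h1]
      exact mul_le_of_le_one_right (sq_nonneg _) (by exact_mod_cast hS)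
  · have h1 : (a / (m * √m)) ^ 2 * (2 * n / m) / σ ^ 2 = 2 * a ^ 2 / σ ^ 2 * (n / m ^ 4) := by
      rw [hA2]; field_simp
    have h3 : (a / (m * √m)) ^ 2 * (2 * n / m) / σ ^ 2 ≤ Real.log n * (1 / 16) := by
      rw [h1, mul_comm]
      gcongr
    have h16 : (n : ℝ) ^ (1 / 8 : ℝ) = (n : ℝ) ^ (1 / 16 : ℝ) * (n : ℝ) ^ (1 / 16 : ℝ) := by
      rw [← Real.rpow_add hn0]; norm_num
    calc _ ≤ Real.exp (Real.log n * (1 / 16)) := Real.exp_le_exp.2 h3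
      _ = (n : ℝ) ^ (1 / 16 : ℝ) := (Real.rpow_def_of_pos hn0 _).symm
      _ ≤ m / 2 := by nlinarith

/-- The erasing adversary with erasure probability `p = κ n^(β - 1)`, which keeps the expected number
of erasures below `q / 2`. -/
theorem minimaxRisk_ge_adversarial {σ : ℝ} (hσ : 0 < σ) {m₁ : ℝ≥0∞} (hm₁ : 0 < m₁) {β : ℝ}
    (hβ : β ≤ 1) {q : ℕ → ℕ}
    (hq : (fun n : ℕ => (n : ℝ) ^ β) =O[atTop] fun n : ℕ => (q n : ℝ)) :
    ∃ c : ℝ, 0 < c ∧ ∀ᶠ n : ℕ in atTop, ∀ (x : Fin n → ℝ) (L m₂ : ℝ≥0∞),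
      ENNReal.ofReal (c * (n : ℝ) ^ (-2 * (1 - β))) ≤ minimaxRisk lossTwo σ m₁ L m₂ x (q n) ∧
      ENNReal.ofReal (c * (n : ℝ) ^ (-2 * (1 - β))) ≤ minimaxRisk lossSup σ m₁ L m₂ x (q n) := by
  obtain ⟨r, hr, hrm⟩ := exists_pos_ofReal_le hm₁
  obtain ⟨C, hC, hCq⟩ := hq.exists_pos
  set κ := min (1 / 2) (min (1 / (2 * C)) (r / (3 * σ))) with hκ
  have hκpos : 0 < κ := by positivity
  have hκ1 : κ ≤ 1 / 2 := min_le_left _ _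
  have hκ2 : κ * (2 * C) ≤ 1 := by
    rw [← le_div_iff₀ (by positivity)]
    exact (min_le_right _ _).trans (min_le_left _ _)
  have hκ3 : κ * (3 * σ) ≤ r := by
    rw [← le_div_iff₀ (by positivity)]
    exact (min_le_right _ _).trans (min_le_right _ _)
  refine ⟨(σ * κ) ^ 2 / 2, by positivity, ?_⟩
  filter_upwards [eventually_ge_atTop 1, hCq.bound] with n hn hbound x L m₂
  have hn1 : (1 : ℝ) ≤ n := by exact_mod_cast hn
  have hn0 : (0 : ℝ) < n := by linarith
  rw [Real.norm_of_nonneg (by positivity), Real.norm_of_nonneg (by positivity)] at hbound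
  set u := (n : ℝ) ^ (β - 1) with hu
  have hu0 : 0 < u := by positivity
  have hu1 : u ≤ 1 := Real.rpow_le_one_of_one_le_of_nonpos hn1 (by linarith)
  have hnu : n * u = (n : ℝ) ^ β := by
    rw [hu, Real.rpow_sub_one hn0.ne']; field_simp
  have hu2 : (n : ℝ) ^ (-2 * (1 - β)) = u ^ 2 := by
    rw [hu, ← Real.rpow_natCast, ← Real.rpow_mul hn0.le]
    congr 1; push_cast; ring
  have hval : (σ * κ) ^ 2 / 2 * u ^ 2 = (σ * (κ * u)) ^ 2 / 2 := by ring
  have hp1 : κ * u ≤ 1 / 2 := by nlinarith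
  have hpm : ENNReal.ofReal (3 * σ * (κ * u)) ≤ m₁ := by
    refine (ENNReal.ofReal_le_ofReal ?_).trans hrm
    nlinarith [mul_le_of_le_one_right (by positivity : 0 ≤ κ * (3 * σ)) hu1]
  have hnp : 2 * n * (κ * u) ≤ q n := by
    calc 2 * n * (κ * u) = 2 * κ * (n * u) := by ring
      _ ≤ 2 * κ * (C * q n) := by rw [hnu]; gcongr
      _ = κ * (2 * C) * q n := by ring
      _ ≤ q n := mul_le_of_le_one_left (by positivity) hκ2
  rw [hu2, hval]
  exact ⟨minimaxRisk_lossTwo_ge_erasure hσ (by positivity) hp1 hpm hnp x,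
    minimaxRisk_lossSup_ge_erasure hσ (by positivity) hp1 hpm hnp x⟩

end AdvRegression

theorem mainTheorem6 (σ : ℝ) (hσ : 0 < σ) (m₁ L m₂ : ℝ≥0∞)
    (hm₁ : 0 < m₁) (hL : 0 < L) (hm₂ : 0 < m₂)
    (β : ℝ) (hβ : β ∈ Icc (0 : ℝ) 1) (q : ℕ → ℕ)
    (hq : (fun n : ℕ => (q n : ℝ)) =Θ[atTop] fun n : ℕ => (n : ℝ) ^ β) :
    ∃ c : ℝ, 0 < c ∧ ∀ᶠ n : ℕ in atTop, ∀ x : Fin n → ℝ, (∀ i, x i ∈ Icc (0 : ℝ) 1) →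
      (β ≤ 11 / 15 →
        ENNReal.ofReal (c * (n : ℝ) ^ (-(4 / 5) : ℝ)) ≤
          AdvRegression.minimaxRisk AdvRegression.lossTwo σ m₁ L m₂ x (q n)) ∧
      (11 / 15 < β →
        ENNReal.ofReal (c * (n : ℝ) ^ (-3 * (1 - β))) ≤
          AdvRegression.minimaxRisk AdvRegression.lossTwo σ m₁ L m₂ x (q n)) ∧
      (β ≤ 5 / 8 →
        ENNReal.ofReal (c * (Real.log n / n) ^ (3 / 4 : ℝ)) ≤
          AdvRegression.minimaxRisk AdvRegression.lossSup σ m₁ L m₂ x (q n)) ∧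
      (5 / 8 < β →
        ENNReal.ofReal (c * (n : ℝ) ^ (-2 * (1 - β))) ≤
          AdvRegression.minimaxRisk AdvRegression.lossSup σ m₁ L m₂ x (q n)) := by
  obtain ⟨c₁, hc₁, h₁⟩ := AdvRegression.minimaxRisk_lossTwo_ge_nonparametric hσ hm₁ hL
  obtain ⟨c₂, hc₂, h₂⟩ := AdvRegression.minimaxRisk_lossSup_ge_nonparametric hσ hm₁ hL
  obtain ⟨c₃, hc₃, h₃⟩ := AdvRegression.minimaxRisk_ge_adversarial hσ hm₁ hβ.2 hq.2
  refine ⟨min c₁ (min c₂ c₃), by positivity, ?_⟩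
  have hle₁ : min c₁ (min c₂ c₃) ≤ c₁ := min_le_left _ _
  have hle₂ : min c₁ (min c₂ c₃) ≤ c₂ := (min_le_right _ _).trans (min_le_left _ _)
  have hle₃ : min c₁ (min c₂ c₃) ≤ c₃ := (min_le_right _ _).trans (min_le_right _ _)
  filter_upwards [h₁, h₂, h₃, eventually_ge_atTop 1] with n h₁ h₂ h₃ hn x _
  have hn1 : (1 : ℝ) ≤ n := by exact_mod_cast hn
  have hlog : 0 ≤ Real.log n / n := div_nonneg (Real.log_nonneg hn1) (by linarith)
  refine ⟨fun _ => le_trans ?_ (h₁ x (q n) m₂), fun _ => le_trans ?_ (h₃ x L m₂).1,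
    fun _ => le_trans ?_ (h₂ x (q n) m₂), fun _ => le_trans ?_ (h₃ x L m₂).2⟩
  all_goals refine ENNReal.ofReal_le_ofReal ?_
  · gcongr
  · gcongr ?_ * ?_
    exact Real.rpow_le_rpow_of_exponent_le hn1 (by linarith [hβ.2])
  · gcongr
  · gcongr
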